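/- Let $d\ge 2$, $\mu>-1/2$, let $B=\{x\in\mathbb R^d:|x|\le1\}$ and $dW_\mu(x)=(1-|x|^2)^{\mu-1/2}\,dx$ on $B$. For $\varphi\in C^1$ put $\partial_r\varphi(x)=\sum_j\frac{x_j}{|x|}\partial_j\varphi(x)$ and $\nabla_0\varphi(x)=|x|\nabla\varphi(x)-x\,\partial_r\varphi(x)$, $x\neq0$. Let $U=\{0<|x|<1\}$. For $f\in L^2_{\rm loc}(U)$ we say that $\partial_rf=h\in L^2_{\rm loc}(U)$, respectively $\nabla_0f=k\in L^2_{\rm loc}(U;\mathbb R^d)$, in the $L^2$ distribution sense if $$\int_B h\,\varphi\,dx=-\int_B f\Big(\partial_r\varphi+\frac{d-1}{|x|}\varphi\Big)dx,\qquad\text{respectively}\qquad \int_B k\,\varphi\,dx=-\int_B f\Big(\nabla_0\varphi-(d-1)\frac{x}{|x|}\varphi\Big)dx,$$ for all $\varphi\in C^1_c(U)$. When both exist put $\Gamma(f,f)=(1-|x|^2)|\partial_rf|^2+|x|^{-2}|\nabla_0f|^2$. Let $D(\overline{\mathcal E})$ be the set of $f\in L^2(B,W_\mu)$ whose derivatives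 $\partial_rf,\nabla_0f$ exist in this sense with $\sqrt{1-|x|^2}\,\partial_rf$ and $|x|^{-1}|\nabla_0f|$ in $L^2(B,W_\mu)$, and for which there are $f_n\in C^2(B)$ with $f_n\to f$, $\sqrt{1-|x|^2}\,\partial_r(f_n-f)\to0$ and $|x|^{-1}|\nabla_0(f_n-f)|\to0$ in $L^2(B,W_\mu)$. Define, for $x,y\in B$, the intrinsic distance $$\rho_I(x,y)=\sup\{f(x)-f(y):f\in D(\overline{\mathcal E})\cap C(B),\ \Gamma(f,f)\le1\text{ a.e. in }B\}$$ and the geodesic distance $\rho(x,y)=\arccos\big(\langle x,y\rangle+\sqrt{1-|x|^2}\sqrt{1-|y|^2}\big)$. (1) For all $x,y\in B$ we have $\rho_I(x,y)=\rho(x,y)$. (2) Let $f\in L^2_{\rm loc}(U)$ be such that $\partial_rf$ and $\nabla_0f$ exist in the $L^2$ distribution sense and $\Gamma(f,f)\le1$ a.e. in $B$. Let $S^d_+=\{\xi\in\mathbb R^{d+1}:|\xi|=1,\ \xi_{d+1}\ge0\}$, $\pi(\xi)=(\xi_1,\dots,\xi_d)$, and $\mathrm{dist}(\xi,\zeta)=\arccos\langle\xi,\zeta\rangle$.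 Then $f\circ\pi$ coincides a.e. on $S^d_+$, with respect to the area measure, with a continuous function $F$ on $S^d_+$ satisfying $|F(\xi)-F(\zeta)|\le\mathrm{dist}(\xi,\zeta)$ for all $\xi,\zeta\in S^d_+$, and $f$ coincides a.e. in $B$ with a continuous function $g$ on $B$ satisfying $|g(x)-g(y)|\le\rho(x,y)$ for all $x,y\in B$. -/

import Mathlib

open MeasureTheory Metric Set Filter Topology

noncomputable section

/-- The space `ℝ^d` with its Euclidean norm. -/
abbrev Euc (d : ℕ) : Type := EuclideanSpace ℝ (Fin d)

/-- The closed unit ball `B` of `ℝ^d`. -/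
abbrev cBall (d : ℕ) : Set (Euc d) := closedBall (0 : Euc d) 1

/-- The open unit ball without its centre. -/
abbrev puncBall (d : ℕ) : Set (Euc d) := ball (0 : Euc d) 1 \ {0}

/-- The measure `(1 - |x|²)^(μ - 1/2) dx` on the closed unit ball. -/
def ballMeasure (d : ℕ) (μ : ℝ) : Measure (Euc d) :=
  (volume.restrict (cBall d)).withDensity
    (fun x => ENNReal.ofReal ((1 - ‖x‖ ^ 2) ^ (μ - 1 / 2)))

/-- `f ∈ L²_loc(U)`: square integrable on every compact subset of `U`. -/
def IsL2Loc {d : ℕ} {F : Type*} [NormedAddCommGroup F] (U : Set (Euc d)) (f : Euc d → F) : Prop :=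
  ∀ K : Set (Euc d), IsCompact K → K ⊆ U → MemLp f 2 (volume.restrict K)

/-- `φ ∈ C_c^1(U)`, extended by zero to all of `ℝ^d`. -/
def IsTestFn {d : ℕ} (U : Set (Euc d)) (φ : Euc d → ℝ) : Prop :=
  ContDiff ℝ 1 φ ∧ HasCompactSupport φ ∧ tsupport φ ⊆ U

/-- The classical radial derivative `∑ⱼ (xⱼ / |x|) ∂ⱼ f(x)`. -/
def radialDeriv {d : ℕ} (f : Euc d → ℝ) (x : Euc d) : ℝ :=
  ∑ j : Fin d, (x j / ‖x‖) * fderiv ℝ f x (EuclideanSpace.single j 1)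

/-- The classical spherical gradient `|x| ∇f(x) - x ∂_r f(x)`. -/
def sphGrad {d : ℕ} (f : Euc d → ℝ) (x : Euc d) : Euc d :=
  ‖x‖ • gradient f x - radialDeriv f x • x

/-- `h` is the radial derivative of `f` in the `L²` distribution sense in the punctured ball. -/
def HasL2RadialDeriv {d : ℕ} (f h : Euc d → ℝ) : Prop :=
  IsL2Loc (puncBall d) f ∧ IsL2Loc (puncBall d) h ∧
    ∀ φ : Euc d → ℝ, IsTestFn (puncBall d) φ →
      ∫ x in cBall d, h x * φ x =
        -∫ x in cBall d, f x * (radialDeriv φ x + ((d : ℝ) - 1) / ‖x‖ * φ x)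

/-- `h` is the spherical gradient of `f` in the `L²` distribution sense in the punctured ball. -/
def HasL2SphGrad {d : ℕ} (f : Euc d → ℝ) (h : Euc d → Euc d) : Prop :=
  IsL2Loc (puncBall d) f ∧ IsL2Loc (puncBall d) h ∧
    ∀ φ : Euc d → ℝ, IsTestFn (puncBall d) φ →
      ∫ x in cBall d, φ x • h x =
        -∫ x in cBall d, f x • (sphGrad φ x - (((d : ℝ) - 1) / ‖x‖ * φ x) • x)

theorem IsL2Loc.locallyIntegrableOn {d : ℕ} {F : Type*} [NormedAddCommGroup F]
    {f : Euc d → F} (hf : IsL2Loc (puncBall d) f) :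
    LocallyIntegrableOn f (puncBall d) volume := by
  have ho : IsOpen (puncBall d) := isOpen_ball.sdiff isClosed_singleton
  rw [locallyIntegrableOn_iff ho.isLocallyClosed]
  intro K hKU hK
  have : IsFiniteMeasure (volume.restrict K) := ⟨by simpa using hK.measure_lt_top⟩
  exact (hf K hK hKU).integrable (by norm_num)

theorem ae_eq_of_integral_smul_eq {d : ℕ} {F : Type*} [NormedAddCommGroup F] [NormedSpace ℝ F]
    [CompleteSpace F] {h h' : Euc d → F}
    (hh : IsL2Loc (puncBall d) h) (hh' : IsL2Loc (puncBall d) h')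
    (H : ∀ φ : Euc d → ℝ, IsTestFn (puncBall d) φ →
      ∫ x in cBall d, φ x • h x = ∫ x in cBall d, φ x • h' x) :
    ∀ᵐ x, x ∈ puncBall d → h x = h' x := by
  have ho : IsOpen (puncBall d) := isOpen_ball.sdiff isClosed_singleton
  have h1 := hh.locallyIntegrableOn
  have h2 := hh'.locallyIntegrableOn
  have key := ho.ae_eq_zero_of_integral_contDiff_smul_eq_zero (h1.sub h2) (μ := volume) ?_
  · filter_upwards [key] with x hx hxU
    exact sub_eq_zero.1 (hx hxU)
  · intro φ hφ hc hs
    have hint : ∀ k : Euc d → F, LocallyIntegrableOn k (puncBall d) volume →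
        Integrable (fun x => φ x • k x) volume := by
      intro k hk
      have hK : IntegrableOn k (tsupport φ) volume :=
        hk.integrableOn_compact_subset hs hc
      have := hK.continuousOn_smul (hφ.continuous.continuousOn (s := tsupport φ)) hc
      refine (integrableOn_iff_integrable_of_support_subset ?_).1 this
      intro x hx
      refine subset_tsupport φ ?_
      simp only [Function.mem_support] at hx ⊢
      intro h0
      exact hx (by simp [h0])
    have hset : ∀ k : Euc d → F,
        ∫ x in cBall d, φ x • k x = ∫ x, φ x • k x := by
      intro k
      refine setIntegral_eq_integral_of_forall_compl_eq_zero ?_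
      intro x hx
      have : φ x = 0 := by
        by_contra h0
        exact hx (ball_subset_closedBall (hs (subset_tsupport φ h0)).1)
      simp [this]
    have e := H φ ⟨hφ.of_le (by exact_mod_cast le_top), hc, hs⟩
    rw [hset, hset] at e
    have : (fun x => φ x • (h - h') x) = fun x => φ x • h x - φ x • h' x := by
      funext x; simp [smul_sub]
    simp only [this]
    rw [integral_sub (hint h h1) (hint h' h2), e, sub_self]

/-- Uniqueness of the `L²` radial derivative. -/
theorem HasL2RadialDeriv.ae_unique {d : ℕ} {f h h' : Euc d → ℝ}
    (H : HasL2RadialDeriv f h) (H' : HasL2RadialDeriv f h') :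
    ∀ᵐ x, x ∈ puncBall d → h x = h' x := by
  refine ae_eq_of_integral_smul_eq H.2.1 H'.2.1 fun φ hφ => ?_
  have := (H.2.2 φ hφ).trans (H'.2.2 φ hφ).symm
  simpa [mul_comm] using this

/-- Uniqueness of the `L²` spherical gradient. -/
theorem HasL2SphGrad.ae_unique {d : ℕ} {f : Euc d → ℝ} {h h' : Euc d → Euc d}
    (H : HasL2SphGrad f h) (H' : HasL2SphGrad f h') :
    ∀ᵐ x, x ∈ puncBall d → h x = h' x :=
  ae_eq_of_integral_smul_eq H.2.1 H'.2.1 fun φ hφ => (H.2.2 φ hφ).trans (H'.2.2 φ hφ).symm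

open Classical in
/-- The `L²` radial derivative `∂_r f`: a representative (it is unique almost everywhere in `B`)
where it exists, and `0` otherwise. -/
def l2RadialDeriv {d : ℕ} (f : Euc d → ℝ) : Euc d → ℝ :=
  if H : ∃ h, HasL2RadialDeriv f h then H.choose else 0

open Classical in
/-- The `L²` spherical gradient `∇₀ f`: a representative (it is unique almost everywhere in `B`)
where it exists, and `0` otherwise. -/
def l2SphGrad {d : ℕ} (f : Euc d → ℝ) : Euc d → Euc d :=
  if H : ∃ h, HasL2SphGrad f h then H.choose else 0

/-- The density of the energy measure,
`Γ(f,g) = (1 - |x|²) ∂_r f ∂_r g + |x|⁻² ∇₀ f · ∇₀ g`. -/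
def energyDensity {d : ℕ} (f g : Euc d → ℝ) (x : Euc d) : ℝ :=
  (1 - ‖x‖ ^ 2) * (l2RadialDeriv f x * l2RadialDeriv g x)
    + 1 / ‖x‖ ^ 2 * inner ℝ (l2SphGrad f x) (l2SphGrad g x)

/-- The domain of the closed Dirichlet form on `L²(B, W_μ)`: the functions that have `L²`
derivatives of finite energy and are limits, in the energy norm, of functions in `C²(B)`. -/
def InFormDomain {d : ℕ} (μ : ℝ) (f : Euc d → ℝ) : Prop :=
  MemLp f 2 (ballMeasure d μ) ∧
  (∃ h, HasL2RadialDeriv f h) ∧ (∃ h, HasL2SphGrad f h) ∧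
  MemLp (fun x => √(1 - ‖x‖ ^ 2) * l2RadialDeriv f x) 2 (ballMeasure d μ) ∧
  MemLp (fun x => 1 / ‖x‖ * ‖l2SphGrad f x‖) 2 (ballMeasure d μ) ∧
  ∃ u : ℕ → Euc d → ℝ, (∀ n, ContDiffOn ℝ 2 (u n) (cBall d)) ∧
    Tendsto (fun n => eLpNorm (fun x => u n x - f x) 2 (ballMeasure d μ)) atTop (𝓝 0) ∧
    Tendsto (fun n => eLpNorm
      (fun x => √(1 - ‖x‖ ^ 2) * (radialDeriv (u n) x - l2RadialDeriv f x)) 2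
      (ballMeasure d μ)) atTop (𝓝 0) ∧
    Tendsto (fun n => eLpNorm
      (fun x => 1 / ‖x‖ * ‖sphGrad (u n) x - l2SphGrad f x‖) 2
      (ballMeasure d μ)) atTop (𝓝 0)

/-- `Γ(f,f) ≤ 1` almost everywhere in `B`. -/
def EnergyLeOne {d : ℕ} (f : Euc d → ℝ) : Prop :=
  ∀ᵐ z ∂(volume.restrict (cBall d)), energyDensity f f z ≤ 1

/-- The intrinsic distance on `B`, a supremum in the extended reals. -/
def intrinsicDist {d : ℕ} (μ : ℝ) (x y : Euc d) : EReal :=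
  sSup {r : EReal | ∃ f : Euc d → ℝ, InFormDomain μ f ∧ ContinuousOn f (cBall d) ∧
    EnergyLeOne f ∧ r = ((f x - f y : ℝ) : EReal)}

/-- The geodesic distance on the ball. -/
def ballDist {d : ℕ} (x y : Euc d) : ℝ :=
  Real.arccos (inner ℝ x y + √(1 - ‖x‖ ^ 2) * √(1 - ‖y‖ ^ 2))

/-- The geodesic distance on the unit sphere. -/
def geoDist {d : ℕ} (ξ ζ : Euc d) : ℝ := Real.arccos (inner ℝ ξ ζ)

/-- The closed upper hemisphere `S^d_+` of the unit sphere of `ℝ^(d+1)`. -/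
def hemisphere (d : ℕ) : Set (Euc (d + 1)) := {ξ | ‖ξ‖ = 1 ∧ 0 ≤ ξ (Fin.last d)}

/-- The projection `(x₁, …, x_d, x_{d+1}) ↦ (x₁, …, x_d)`. -/
def dropLast {d : ℕ} (ξ : Euc (d + 1)) : Euc d := WithLp.toLp 2 (fun i => ξ i.castSucc)

/-- The area measure on the unit sphere of `ℝ^(d+1)`. -/
abbrev areaMeasure (d : ℕ) : Measure (sphere (0 : Euc (d + 1)) 1) :=
  (volume : Measure (Euc (d + 1))).toSphere

end

/-! Under the lift x ↦ (x, √(1 − |x|²)) the ball becomes the upper hemisphere, `ballDist` becomes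
spherical distance, and `Γ(f,f)` becomes the squared gradient for the round metric. In Euclidean
terms Γ(f,f) = |∇f|² − ⟨∇f, x⟩², and the squared length of a tangent vector w at x is |w|² + ⟨x, w⟩²
/ (1 − |x|²). Both parts thus say that a gradient bound by one is the same as being 1-Lipschitz for
geodesic distance.

From gradient to Lipschitz (`exists_lipschitz_representative`): the radial and spherical derivatives
combine into a Euclidean weak gradient v on the punctured ball, and Γ ≤ 1 gives |⟨w, v⟩| ≤ length of
w by Cauchy–Schwarz (`exists_weakGradient`). For linearly independent x and y the great arc between
their lifts projects to a curve avoiding the origin and the boundary. Mollifications of f have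
derivative at most 1 + ε along this curve once the radius is small, so they vary by at most (1 + ε)
times the arc length. They converge to f almost everywhere, so f is 1-Lipschitz on a conull set of
points, first for independent pairs and then for all pairs by a detour through a third point.
McShane's extension gives the representative on the closed ball. It transfers to the hemisphere
because ball null sets lift to area null sets.

Lower bound for the intrinsic distance (`ballDist_le_intrinsicDist`): the distance to y would be the
optimal function, but it is not C² on the closed ball. In arccos = π/2 − arcsin the height √(1 −
|x|²) is regularized to √(1 + η² − |x|²), and division by √(1 + 3η) restores energy at most one. The
resulting functions are C² up to the boundary and recover `ballDist` as η → 0. The weight enters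
only through the finiteness of W_μ and its absolute continuity. -/

/-- The point of the closed upper hemisphere above a point of the closed ball. -/
noncomputable def ballLift {d : ℕ} (x : Euc d) : WithLp 2 (Euc d × ℝ) := WithLp.toLp 2 (x, √(1 - ‖x‖ ^ 2))

/-! ### Spherical geometry of the ball -/

theorem one_sub_norm_sq_nonneg {d : ℕ} {x : Euc d} (hx : x ∈ cBall d) : 0 ≤ 1 - ‖x‖ ^ 2 := by
  have h1 : ‖x‖ ≤ 1 := by simpa using hx
  nlinarith [norm_nonneg x]

theorem one_sub_norm_sq_pos {d : ℕ} {x : Euc d} (hx : x ∈ puncBall d) : 0 < 1 - ‖x‖ ^ 2 := by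
  have h1 : ‖x‖ < 1 := by simpa using hx.1
  nlinarith [norm_nonneg x]

theorem puncBall_subset_cBall {d : ℕ} : puncBall d ⊆ cBall d :=
  fun _ hx => ball_subset_closedBall hx.1

theorem isOpen_puncBall {d : ℕ} : IsOpen (puncBall d) := isOpen_ball.sdiff isClosed_singleton

theorem inner_ballLift {d : ℕ} (x y : Euc d) :
    inner ℝ (ballLift x) (ballLift y) =
      inner ℝ x y + √(1 - ‖x‖ ^ 2) * √(1 - ‖y‖ ^ 2) := by
  simp [ballLift, WithLp.prod_inner_apply, mul_comm]

theorem norm_ballLift {d : ℕ} {x : Euc d} (hx : x ∈ cBall d) : ‖ballLift x‖ = 1 := by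
  have h : ‖ballLift x‖ ^ 2 = 1 := by
    rw [← real_inner_self_eq_norm_sq, inner_ballLift, real_inner_self_eq_norm_sq,
      Real.mul_self_sqrt (one_sub_norm_sq_nonneg hx)]
    ring
  exact (pow_eq_one_iff_of_nonneg (norm_nonneg _) two_ne_zero).1 h

theorem ballDist_eq_angle {d : ℕ} {x y : Euc d} (hx : x ∈ cBall d) (hy : y ∈ cBall d) :
    ballDist x y = InnerProductGeometry.angle (ballLift x) (ballLift y) := by
  rw [InnerProductGeometry.angle, norm_ballLift hx, norm_ballLift hy, inner_ballLift, ballDist]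
  simp

theorem ballDist_triangle {d : ℕ} {x y z : Euc d} (hx : x ∈ cBall d) (hy : y ∈ cBall d)
    (hz : z ∈ cBall d) : ballDist x z ≤ ballDist x y + ballDist y z := by
  rw [ballDist_eq_angle hx hy, ballDist_eq_angle hy hz, ballDist_eq_angle hx hz]
  exact InnerProductGeometry.angle_le_angle_add_angle _ _ _

theorem ballDist_comm {d : ℕ} (x y : Euc d) : ballDist x y = ballDist y x := by
  rw [ballDist, ballDist, real_inner_comm, mul_comm]

theorem ballDist_self {d : ℕ} {x : Euc d} (hx : x ∈ cBall d) : ballDist x x = 0 := by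
  rw [ballDist, real_inner_self_eq_norm_sq, Real.mul_self_sqrt (one_sub_norm_sq_nonneg hx)]
  simp

theorem ballDist_nonneg {d : ℕ} (x y : Euc d) : 0 ≤ ballDist x y := Real.arccos_nonneg _

@[fun_prop]
theorem Continuous.ballDist {d : ℕ} {X : Type*} [TopologicalSpace X] {a b : X → Euc d}
    (ha : Continuous a) (hb : Continuous b) : Continuous fun x => ballDist (a x) (b x) := by
  unfold _root_.ballDist
  exact Real.continuous_arccos.comp (by fun_prop)

/-- Independence makes Cauchy–Schwarz strict: |y|²x − ⟨x, y⟩y is nonzero, and its squared norm is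
|y|² times the gap. The spherical angle then lies strictly between 0 and π, so its sine can be a
denominator in the arc. -/
theorem abs_inner_add_sqrt_lt_one {d : ℕ} {x y : Euc d} (hx : x ∈ cBall d) (hy : y ∈ cBall d)
    (hxy : ∀ a b : ℝ, a • x + b • y = 0 → a = 0 ∧ b = 0) :
    |inner ℝ x y + √(1 - ‖x‖ ^ 2) * √(1 - ‖y‖ ^ 2)| < 1 := by
  have hy0 : y ≠ 0 := fun h => by simpa using (hxy 0 1 (by simp [h])).2
  have hyn : 0 < ‖y‖ := norm_pos_iff.2 hy0
  have h1 : |inner ℝ x y| < ‖x‖ * ‖y‖ := by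
    refine abs_lt_of_sq_lt_sq ?_ (by positivity)
    have hne : ‖y‖ ^ 2 • x + (-inner ℝ x y) • y ≠ 0 := fun h => by
      have := (hxy _ _ h).1
      exact hyn.ne' (by simpa using this)
    have hpos : 0 < ‖‖y‖ ^ 2 • x + (-inner ℝ x y) • y‖ ^ 2 := by positivity
    rw [norm_add_sq_real, norm_smul, norm_smul, inner_smul_left, inner_smul_right, norm_neg,
      Real.norm_eq_abs, Real.norm_eq_abs, mul_pow, mul_pow, sq_abs, sq_abs] at hpos
    simp only [conj_trivial] at hpos
    have : 0 < ‖y‖ ^ 2 * ((‖x‖ * ‖y‖) ^ 2 - inner ℝ x y ^ 2) := by nlinarith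
    have := pos_of_mul_pos_right this (by positivity)
    linarith
  have hsx := Real.sq_sqrt (one_sub_norm_sq_nonneg hx)
  have hsy := Real.sq_sqrt (one_sub_norm_sq_nonneg hy)
  have hs : 0 ≤ √(1 - ‖x‖ ^ 2) * √(1 - ‖y‖ ^ 2) := by positivity
  calc _ ≤ |inner ℝ x y| + |√(1 - ‖x‖ ^ 2) * √(1 - ‖y‖ ^ 2)| := abs_add_le _ _
    _ < ‖x‖ * ‖y‖ + √(1 - ‖x‖ ^ 2) * √(1 - ‖y‖ ^ 2) := by
      rw [abs_of_nonneg hs]; linarith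
    _ ≤ 1 := by
      nlinarith [sq_nonneg (‖x‖ - ‖y‖), sq_nonneg (√(1 - ‖x‖ ^ 2) - √(1 - ‖y‖ ^ 2))]

/-- The great arc between two points of the hemisphere, projected to the ball. -/
theorem exists_unit_speed_arc {d : ℕ} {x y : Euc d} (hx : x ∈ puncBall d) (hy : y ∈ puncBall d)
    (hxy : ∀ a b : ℝ, a • x + b • y = 0 → a = 0 ∧ b = 0) :
    ∃ γ γ' : ℝ → Euc d, γ 0 = x ∧ γ (ballDist x y) = y ∧ Continuous γ' ∧
      (∀ t, HasDerivAt γ (γ' t) t) ∧ ∀ t ∈ Icc 0 (ballDist x y), γ t ∈ puncBall d ∧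
        ‖γ' t‖ ^ 2 * (1 - ‖γ t‖ ^ 2) + inner ℝ (γ t) (γ' t) ^ 2 = 1 - ‖γ t‖ ^ 2 := by
  have hlt := abs_lt.1 (abs_inner_add_sqrt_lt_one (puncBall_subset_cBall hx)
    (puncBall_subset_cBall hy) hxy)
  set T := ballDist x y with hT
  have hcos : Real.cos T = inner ℝ x y + √(1 - ‖x‖ ^ 2) * √(1 - ‖y‖ ^ 2) :=
    Real.cos_arccos hlt.1.le hlt.2.le
  set sx := √(1 - ‖x‖ ^ 2) with hsx
  set sy := √(1 - ‖y‖ ^ 2) with hsy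
  have hsx2 : sx ^ 2 = 1 - ‖x‖ ^ 2 := Real.sq_sqrt (one_sub_norm_sq_pos hx).le
  have hsy2 : sy ^ 2 = 1 - ‖y‖ ^ 2 := Real.sq_sqrt (one_sub_norm_sq_pos hy).le
  have hsx0 : 0 < sx := Real.sqrt_pos.2 (one_sub_norm_sq_pos hx)
  have hsy0 : 0 < sy := Real.sqrt_pos.2 (one_sub_norm_sq_pos hy)
  have hT0 : 0 < T := Real.arccos_pos.2 hlt.2
  have hTpi : T < Real.pi := by
    refine lt_of_le_of_ne (Real.arccos_le_pi _) fun h => ?_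
    rw [h, Real.cos_pi] at hcos
    linarith
  have hS : 0 < Real.sin T := Real.sin_pos_of_pos_of_lt_pi hT0 hTpi
  -- The left side is the inner product in ℝ^(d+1) of two combinations of the lifts, which are unit
  -- vectors at angle T.
  have key : ∀ a b a' b' : ℝ,
      inner ℝ (a • x + b • y) (a' • x + b' • y) + (a * sx + b * sy) * (a' * sx + b' * sy) =
        a * a' + b * b' + (a * b' + a' * b) * Real.cos T := by
    intro a b a' b'
    simp only [inner_add_left, inner_add_right, real_inner_smul_left, real_inner_smul_right,
      real_inner_self_eq_norm_sq, real_inner_comm x y, hcos]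
    linear_combination a * a' * hsx2 + b * b' * hsy2
  -- Coefficients of spherical linear interpolation between the two lifts.
  set p : ℝ → ℝ := fun t => Real.sin (T - t) / Real.sin T with hp
  set q : ℝ → ℝ := fun t => Real.sin t / Real.sin T with hq
  set p' : ℝ → ℝ := fun t => -Real.cos (T - t) / Real.sin T with hp'
  set q' : ℝ → ℝ := fun t => Real.cos t / Real.sin T with hq'
  have hpd : ∀ t, HasDerivAt p (p' t) t := fun t => by
    have := (((hasDerivAt_id t).const_sub T).sin).div_const (Real.sin T)
    simpa using this
  have hqd : ∀ t, HasDerivAt q (q' t) t := fun t => (Real.hasDerivAt_sin t).div_const _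
  refine ⟨fun t => p t • x + q t • y, fun t => p' t • x + q' t • y, ?_, ?_, ?_, ?_, ?_⟩
  · simp [hp, hq, hS.ne']
  · simp [hp, hq, hS.ne']
  · simp only [hp', hq']
    fun_prop
  · exact fun t => ((hpd t).smul_const x).add ((hqd t).smul_const y)
  · intro t ht
    have e1 := key (p t) (q t) (p t) (q t)
    have e2 := key (p t) (q t) (p' t) (q' t)
    have e3 := key (p' t) (q' t) (p' t) (q' t)
    have t1 := Real.sin_sq_add_cos_sq T
    have t2 := Real.sin_sq_add_cos_sq t
    -- The lifted curve stays on the sphere (`c1`), its velocity is tangent (`c2`) and has unit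
    -- length (`c3`).
    have c1 : p t * p t + q t * q t + (p t * q t + p t * q t) * Real.cos T = 1 := by
      simp only [hp, hq]
      field_simp
      rw [Real.sin_sub]
      linear_combination Real.sin T ^ 2 * t2 - Real.sin t ^ 2 * t1
    have c2 : p t * p' t + q t * q' t + (p t * q' t + p' t * q t) * Real.cos T = 0 := by
      simp only [hp, hq, hp', hq']
      field_simp
      rw [Real.sin_sub, Real.cos_sub]
      linear_combination (-Real.cos t * Real.sin t) * t1
    have c3 : p' t * p' t + q' t * q' t + (p' t * q' t + p' t * q' t) * Real.cos T = 1 := by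
      simp only [hp', hq']
      field_simp
      rw [Real.cos_sub]
      linear_combination Real.sin T ^ 2 * t2 - Real.cos t ^ 2 * t1
    rw [c1, real_inner_self_eq_norm_sq] at e1
    rw [c2] at e2
    rw [c3, real_inner_self_eq_norm_sq] at e3
    have hp0 : 0 ≤ p t := div_nonneg (Real.sin_nonneg_of_nonneg_of_le_pi (by linarith [ht.2])
      (by linarith [ht.1])) hS.le
    have hq0 : 0 ≤ q t := div_nonneg (Real.sin_nonneg_of_nonneg_of_le_pi ht.1
      (by linarith [ht.2])) hS.le
    have hne : p t • x + q t • y ≠ 0 := fun h => by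
      obtain ⟨h1, h2⟩ := hxy _ _ h
      rw [h1, h2] at c1
      simp at c1
    -- This is the last coordinate of the lifted arc; its positivity keeps the projection off the
    -- boundary sphere.
    have hσ : 0 < p t * sx + q t * sy := by
      rcases hp0.lt_or_eq with h | h
      · have := mul_nonneg hq0 hsy0.le
        have := mul_pos h hsx0
        linarith
      · rcases hq0.lt_or_eq with h' | h'
        · rw [← h]
          have := mul_pos h' hsy0
          linarith
        · exact absurd (by rw [← h, ← h']; simp) hne
    refine ⟨⟨?_, hne⟩, ?_⟩
    · rw [mem_ball_zero_iff]
      nlinarith [norm_nonneg (p t • x + q t • y)]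
    · dsimp only
      -- With height σ one has ⟨γ, γ'⟩ = −σσ' and |γ'|² = 1 − σ'²; the claim is the unit speed
      -- identity multiplied by σ² = 1 − |γ|².
      have hi : inner ℝ (p t • x + q t • y) (p' t • x + q' t • y)
        = -((p t * sx + q t * sy) * (p' t * sx + q' t * sy)) := by linarith
      have h1 : 1 - ‖p t • x + q t • y‖ ^ 2 = (p t * sx + q t * sy) ^ 2 := by linarith
      have h2 : ‖p' t • x + q' t • y‖ ^ 2 = 1 - (p' t * sx + q' t * sy) ^ 2 := by linarith
      rw [hi, h1, h2]
      ring

/-! ### Euclidean form of the radial and spherical derivatives -/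

section Calculus

variable {d : ℕ}

theorem sum_smul_single (x : Euc d) : ∑ j, x j • EuclideanSpace.single j (1 : ℝ) = x := by
  simpa using (EuclideanSpace.basisFun (Fin d) ℝ).sum_repr x

theorem sum_mul_clm_single (L : Euc d →L[ℝ] ℝ) (x : Euc d) :
    ∑ j, x j * L (EuclideanSpace.single j 1) = L x := by
  conv_rhs => rw [← sum_smul_single x]
  simp

theorem radialDeriv_eq (φ : Euc d → ℝ) (x : Euc d) :
    radialDeriv φ x = ‖x‖⁻¹ * fderiv ℝ φ x x := by
  rw [← sum_mul_clm_single, radialDeriv, Finset.mul_sum]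
  refine Finset.sum_congr rfl fun j _ => ?_
  ring

theorem inner_sphGrad (φ : Euc d → ℝ) (w x : Euc d) :
    inner ℝ w (sphGrad φ x) =
      ‖x‖ * fderiv ℝ φ x w - ‖x‖⁻¹ * fderiv ℝ φ x x * inner ℝ w x := by
  rw [sphGrad, inner_sub_right, inner_smul_right, inner_smul_right, radialDeriv_eq,
    real_inner_comm, gradient, InnerProductSpace.toDual_symm_apply]

theorem hasFDerivAt_norm_inv {x : Euc d} (hx : x ≠ 0) :
    HasFDerivAt (fun y : Euc d => ‖y‖⁻¹) (-(‖x‖⁻¹ ^ 3) • innerSL ℝ x) x := by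
  have hn : ‖x‖ ≠ 0 := norm_ne_zero_iff.2 hx
  have h1 := (hasStrictFDerivAt_norm_sq x).hasFDerivAt.sqrt (pow_ne_zero 2 hn)
  simp only [Real.sqrt_sq (norm_nonneg _)] at h1
  have h2 := (hasDerivAt_inv hn).comp_hasFDerivAt x h1
  refine h2.congr_fderiv ?_
  ext v
  simp
  field_simp

theorem contDiffOn_norm_inv : ContDiffOn ℝ 1 (fun y : Euc d => ‖y‖⁻¹) {0}ᶜ := fun _ hx =>
  ((contDiffAt_norm ℝ hx).inv (norm_ne_zero_iff.2 hx)).contDiffWithinAt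

end Calculus

/-! ### Test functions on the punctured ball -/

section TestFunctions

variable {d : ℕ} {U : Set (Euc d)} {φ : Euc d → ℝ}

/-- Factors singular at the origin, such as |x|⁻¹, are harmless because the support of a test
function stays away from it. -/
theorem IsTestFn.mul_left {a : Euc d → ℝ} (hφ : IsTestFn (puncBall d) φ)
    (ha : ContDiffOn ℝ 1 a {0}ᶜ) : IsTestFn (puncBall d) (fun x => a x * φ x) := by
  refine ⟨contDiff_iff_contDiffAt.2 fun x => ?_, hφ.2.1.mul_left,
    tsupport_mul_subset_right.trans hφ.2.2⟩
  by_cases hx : x ∈ tsupport φ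
  · exact (ha.contDiffAt (isOpen_compl_singleton.mem_nhds (hφ.2.2 hx).2)).mul hφ.1.contDiffAt
  · have h : (fun x => a x * φ x) =ᶠ[𝓝 x] fun _ => 0 := by
      filter_upwards [notMem_tsupport_iff_eventuallyEq.1 hx] with y hy
      simp [hy]
    exact contDiffAt_const.congr_of_eventuallyEq h

theorem fderiv_eq_zero_of_notMem_tsupport {x : Euc d} (hx : x ∉ tsupport φ) :
    fderiv ℝ φ x = 0 := by
  rw [(notMem_tsupport_iff_eventuallyEq.1 hx).fderiv_eq]
  simp

theorem fderiv_mul_apply {a : Euc d → ℝ} {a' : Euc d →L[ℝ] ℝ} {x : Euc d} (ha : HasFDerivAt a a' x)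
    (hφ : DifferentiableAt ℝ φ x) (v : Euc d) :
    fderiv ℝ (fun y => a y * φ y) x v = a' v * φ x + a x * fderiv ℝ φ x v := by
  rw [(ha.fun_mul hφ.hasFDerivAt).fderiv]
  simp
  ring

theorem integrable_smul_of_locallyIntegrableOn {F : Type*} [NormedAddCommGroup F]
    [NormedSpace ℝ F] {f : Euc d → ℝ} (hf : LocallyIntegrableOn f U volume) {K : Set (Euc d)}
    (hK : IsCompact K) (hKU : K ⊆ U) {ψ : Euc d → F} (hψ : ContinuousOn ψ K)
    (h0 : ∀ x ∉ K, ψ x = 0) : Integrable (fun x => f x • ψ x) volume := by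
  refine (integrableOn_iff_integrable_of_support_subset ?_).1
    ((hf.integrableOn_compact_subset hKU hK).smul_continuousOn hψ hK)
  intro x hx
  by_contra hxK
  exact hx (by simp [h0 x hxK])

theorem ae_mem_puncBall (hd : 2 ≤ d) : ∀ᵐ x ∂(volume.restrict (cBall d)), x ∈ puncBall d := by
  have : Nontrivial (Euc d) := Module.nontrivial_of_finrank_pos (R := ℝ) (by simp; omega)
  have h1 : ∀ᵐ x : Euc d, x ∉ sphere (0 : Euc d) 1 :=
    measure_eq_zero_iff_ae_notMem.1 (Measure.addHaar_sphere _ _ _)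
  have h2 : ∀ᵐ x : Euc d, x ∉ ({0} : Set (Euc d)) :=
    measure_eq_zero_iff_ae_notMem.1 (by simp)
  filter_upwards [ae_restrict_mem isClosed_closedBall.measurableSet, ae_restrict_of_ae h1,
    ae_restrict_of_ae h2] with x hx hx1 hx2
  refine ⟨?_, hx2⟩
  rw [mem_closedBall_zero_iff] at hx
  rw [mem_sphere_zero_iff_norm] at hx1
  exact mem_ball_zero_iff.2 (lt_of_le_of_ne hx hx1)

theorem setIntegral_cBall_congr (hd : 2 ≤ d) {F : Type*} [NormedAddCommGroup F]
    [NormedSpace ℝ F] {f g : Euc d → F} (h : ∀ x ∈ puncBall d, f x = g x) :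
    ∫ x in cBall d, f x = ∫ x in cBall d, g x :=
  integral_congr_ae ((ae_mem_puncBall hd).mono h)

end TestFunctions

/-! ### The weak gradient and its bound in the round metric -/

section WeakGradient

variable {d : ℕ} {f h : Euc d → ℝ} {k : Euc d → Euc d} {φ : Euc d → ℝ}

theorem continuousOn_fderiv_apply_self (hφ : ContDiff ℝ 1 φ) (s : Set (Euc d)) :
    ContinuousOn (fun x => fderiv ℝ φ x x) s :=
  ((hφ.continuous_fderiv one_ne_zero).clm_apply continuous_id).continuousOn

theorem continuousOn_fderiv_apply (hφ : ContDiff ℝ 1 φ) (w : Euc d) (s : Set (Euc d)) :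
    ContinuousOn (fun x => fderiv ℝ φ x w) s :=
  ((hφ.continuous_fderiv one_ne_zero).clm_apply continuous_const).continuousOn

theorem continuousOn_norm_inv {s : Set (Euc d)} (hs : s ⊆ {0}ᶜ) :
    ContinuousOn (fun x : Euc d => ‖x‖⁻¹) s := contDiffOn_norm_inv.continuousOn.mono hs

theorem IsTestFn.tsupport_subset_compl (hφ : IsTestFn (puncBall d) φ) : tsupport φ ⊆ {0}ᶜ :=
  fun _ hx => (hφ.2.2 hx).2

/-- The component of the spherical gradient in a fixed direction, with its divergence term. -/
theorem continuousOn_sphGrad_component (hφ : IsTestFn (puncBall d) φ) (w : Euc d) :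
    ContinuousOn (fun x => ‖x‖ * fderiv ℝ φ x w - ‖x‖⁻¹ * fderiv ℝ φ x x * inner ℝ w x -
      ((d : ℝ) - 1) * ‖x‖⁻¹ * φ x * inner ℝ w x) (tsupport φ) := by
  have h1 := continuousOn_fderiv_apply_self hφ.1 (tsupport φ)
  have h2 := continuousOn_fderiv_apply hφ.1 w (tsupport φ)
  have h3 := continuousOn_norm_inv hφ.tsupport_subset_compl
  have h4 := hφ.1.continuous.continuousOn (s := tsupport φ)
  fun_prop

theorem integrable_mul_sphGrad_component (hf : LocallyIntegrableOn f (puncBall d) volume)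
    (hφ : IsTestFn (puncBall d) φ) (w : Euc d) :
    Integrable (fun x => f x * (‖x‖ * fderiv ℝ φ x w - ‖x‖⁻¹ * fderiv ℝ φ x x * inner ℝ w x -
      ((d : ℝ) - 1) * ‖x‖⁻¹ * φ x * inner ℝ w x)) volume := by
  refine integrable_smul_of_locallyIntegrableOn hf hφ.2.1 hφ.2.2
    (continuousOn_sphGrad_component hφ w) fun x hx => ?_
  simp [fderiv_eq_zero_of_notMem_tsupport hx, image_eq_zero_of_notMem_tsupport hx]

theorem integrable_testFn_smul {F : Type*} [NormedAddCommGroup F] [NormedSpace ℝ F]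
    {k : Euc d → F} (hk : LocallyIntegrableOn k (puncBall d) volume)
    (hφ : IsTestFn (puncBall d) φ) : Integrable (fun x => φ x • k x) volume := by
  refine (integrableOn_iff_integrable_of_support_subset ?_).1
    ((hk.integrableOn_compact_subset hφ.2.2 hφ.2.1).continuousOn_smul
      hφ.1.continuous.continuousOn hφ.2.1)
  intro x hx
  by_contra hxK
  exact hx (by simp [image_eq_zero_of_notMem_tsupport hxK])

theorem locallyIntegrableOn_inner (hk : LocallyIntegrableOn k (puncBall d) volume)
    {a : Euc d → Euc d} (ha : Continuous a) :
    LocallyIntegrableOn (fun x => inner ℝ (a x) (k x)) (puncBall d) volume := by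
  rw [locallyIntegrableOn_iff isOpen_puncBall.isLocallyClosed] at hk ⊢
  intro K hKU hK
  have hki := hk K hKU hK
  obtain ⟨C, hC⟩ := hK.exists_bound_of_continuousOn ha.continuousOn
  refine Integrable.mono' (hki.norm.const_mul C)
    (ha.aestronglyMeasurable.inner hki.aestronglyMeasurable) ?_
  filter_upwards [ae_restrict_mem hK.measurableSet] with x hx
  exact (norm_inner_le_norm _ _).trans (mul_le_mul_of_nonneg_right (hC x hx) (norm_nonneg _))

theorem integrable_smul_sphGrad_testFn (hf : LocallyIntegrableOn f (puncBall d) volume)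
    (hφ : IsTestFn (puncBall d) φ) :
    Integrable (fun x => f x • (sphGrad φ x - (((d : ℝ) - 1) / ‖x‖ * φ x) • x)) := by
  refine integrable_smul_of_locallyIntegrableOn hf hφ.2.1 hφ.2.2 ?_ fun x hx => ?_
  · have h1 : ContinuousOn (fun x => fderiv ℝ φ x) (tsupport φ) :=
      (hφ.1.continuous_fderiv one_ne_zero).continuousOn
    have h2 := continuousOn_fderiv_apply_self hφ.1 (tsupport φ)
    have h3 := continuousOn_norm_inv hφ.tsupport_subset_compl
    have h4 := hφ.1.continuous.continuousOn (s := tsupport φ)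
    have h5 : ContinuousOn (fun x => gradient φ x) (tsupport φ) :=
      ((InnerProductSpace.toDual ℝ (Euc d)).symm.continuous).comp_continuousOn h1
    simp only [sphGrad, radialDeriv_eq, div_eq_mul_inv]
    fun_prop
  · simp [sphGrad, gradient, radialDeriv_eq, fderiv_eq_zero_of_notMem_tsupport hx,
      image_eq_zero_of_notMem_tsupport hx]

theorem HasL2SphGrad.integral_inner (hk : HasL2SphGrad f k)
    (hφ : IsTestFn (puncBall d) φ) (w : Euc d) :
    ∫ x in cBall d, φ x * inner ℝ w (k x) =
      -∫ x in cBall d, f x * (‖x‖ * fderiv ℝ φ x w - ‖x‖⁻¹ * fderiv ℝ φ x x * inner ℝ w x -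
        ((d : ℝ) - 1) * ‖x‖⁻¹ * φ x * inner ℝ w x) := by
  have e := congrArg (inner ℝ w) (hk.2.2 φ hφ)
  rw [inner_neg_right, ← _root_.integral_inner, ← _root_.integral_inner] at e
  · simp only [inner_smul_right, inner_sub_right, inner_sphGrad] at e
    rw [e]
    congr 1
  · exact (integrable_smul_sphGrad_testFn hk.1.locallyIntegrableOn hφ).integrableOn
  · exact (integrable_testFn_smul hk.2.1.locallyIntegrableOn hφ).integrableOn

theorem contDiffOn_inner_left (w : Euc d) (s : Set (Euc d)) :
    ContDiffOn ℝ 1 (fun x : Euc d => inner ℝ w x) s :=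
  (innerSL ℝ w).contDiff.contDiffOn

/-- The spherical gradient is tangential. -/
theorem HasL2SphGrad.ae_inner_eq_zero (hd : 2 ≤ d) (hk : HasL2SphGrad f k) :
    ∀ᵐ x, x ∈ puncBall d → inner ℝ x (k x) = 0 := by
  have hloc := locallyIntegrableOn_inner hk.2.1.locallyIntegrableOn continuous_id
  have key := isOpen_puncBall.ae_eq_zero_of_integral_contDiff_smul_eq_zero hloc (μ := volume) ?_
  · exact key
  intro φ hφ1 hφ2 hφ3
  have hφ : IsTestFn (puncBall d) φ := ⟨hφ1.of_le (by exact_mod_cast le_top), hφ2, hφ3⟩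
  set e : Fin d → Euc d := fun j => EuclideanSpace.single j (1 : ℝ)
  have he : ∀ (j : Fin d) (x : Euc d), inner ℝ (e j) x = x j := fun j x => by
    simp [e, EuclideanSpace.inner_single_left]
  -- Testing the j-th component of k against xⱼφ and summing over j produces the integral of φ⟨x,
  -- k⟩.
  have hT : ∀ j, IsTestFn (puncBall d) (fun x => inner ℝ (e j) x * φ x) := fun j =>
    hφ.mul_left (contDiffOn_inner_left _ _)
  have h1 : ∫ x, φ x • inner ℝ (id x) (k x) =
      ∫ x in cBall d, ∑ j, (inner ℝ (e j) x * φ x) * inner ℝ (e j) (k x) := by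
    rw [← setIntegral_eq_integral_of_forall_compl_eq_zero (s := cBall d)]
    · refine integral_congr_ae (Eventually.of_forall fun x => ?_)
      simp only [he, id, smul_eq_mul, PiLp.inner_apply, Finset.mul_sum]
      refine Finset.sum_congr rfl fun j _ => ?_
      simp
      ring
    · intro x hx
      have : φ x = 0 := image_eq_zero_of_notMem_tsupport fun h =>
        hx (puncBall_subset_cBall (hφ3 h))
      simp [this]
  rw [h1, integral_finsetSum]
  · simp_rw [hk.integral_inner (hT _) _]
    rw [Finset.sum_neg_distrib, ← integral_finsetSum]
    · rw [neg_eq_zero, setIntegral_cBall_congr hd (g := fun _ => 0)]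
      · simp
      intro x hx
      have hD : ∀ j v, fderiv ℝ (fun y => inner ℝ (e j) y * φ y) x v =
          v j * φ x + x j * fderiv ℝ φ x v := fun j v => by
        have hL : HasFDerivAt (fun y => inner ℝ (e j) y) (innerSL ℝ (e j)) x :=
          (innerSL ℝ (e j)).hasFDerivAt
        rw [fderiv_mul_apply hL (hφ.1.differentiable one_ne_zero x)]
        simp only [innerSL_apply_apply, he]
      simp only [hD]
      simp only [he]
      rw [← Finset.mul_sum]
      have hx0 : ‖x‖ ≠ 0 := norm_ne_zero_iff.2 hx.2
      have hs : ∑ j, x j * x j = ‖x‖ ^ 2 := by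
        rw [EuclideanSpace.real_norm_sq_eq]
        simp [pow_two]
      have hs1 : ∑ j, x j * fderiv ℝ φ x (e j) = fderiv ℝ φ x x := sum_mul_clm_single _ _
      have hs2 : ∀ j, (e j) j = 1 := fun j => by simp [e]
      simp only [hs2]
      have : ∀ j, ‖x‖ * (1 * φ x + x j * fderiv ℝ φ x (e j)) -
          ‖x‖⁻¹ * (x j * φ x + x j * fderiv ℝ φ x x) * x j -
          ((d : ℝ) - 1) * ‖x‖⁻¹ * (x j * φ x) * x j =
          ‖x‖ * φ x + ‖x‖ * (x j * fderiv ℝ φ x (e j)) -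
          (‖x‖⁻¹ * (φ x + fderiv ℝ φ x x) + ((d : ℝ) - 1) * ‖x‖⁻¹ * φ x) * (x j * x j) := by
        intro j; ring
      simp only [this]
      -- The sum over j gives d|x|φ, which cancels against |x|φ from the radial correction and (d −
      -- 1)|x|φ from the divergence term; the derivatives of φ cancel separately.
      rw [Finset.sum_sub_distrib, Finset.sum_add_distrib, ← Finset.mul_sum, ← Finset.mul_sum,
        ← Finset.mul_sum, hs, hs1]
      simp
      field_simp
      ring_nf
      simp
    · exact fun j _ => (integrable_mul_sphGrad_component hk.1.locallyIntegrableOn (hT j)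
        (e j)).integrableOn
  · exact fun j _ => (integrable_testFn_smul (locallyIntegrableOn_inner
      hk.2.1.locallyIntegrableOn continuous_const) (hT j)).integrableOn

/-- Since ∇ = (x/|x|)∂_r + |x|⁻¹∇₀, the radial identity is tested with ⟨w, x⟩|x|⁻¹φ and the
spherical one with |x|⁻¹φ in direction w; off the origin the two right-hand integrands add up to f
∂_wφ. -/
theorem integral_weakGradient (hd : 2 ≤ d) (hh : HasL2RadialDeriv f h) (hk : HasL2SphGrad f k)
    (hφ : IsTestFn (puncBall d) φ) (w : Euc d) :
    ∫ x, φ x * inner ℝ w ((h x * ‖x‖⁻¹) • x + ‖x‖⁻¹ • k x) = -∫ x, f x * fderiv ℝ φ x w := by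
  have hf := hk.1.locallyIntegrableOn
  have ha : ContDiffOn ℝ 1 (fun x : Euc d => inner ℝ w x * ‖x‖⁻¹) {0}ᶜ :=
    (contDiffOn_inner_left w _).mul contDiffOn_norm_inv
  have hφ1 := hφ.mul_left ha
  have hφ2 := hφ.mul_left contDiffOn_norm_inv
  have eA := hh.2.2 _ hφ1
  have eB := hk.integral_inner hφ2 w
  have iA : Integrable (fun x => h x * (inner ℝ w x * ‖x‖⁻¹ * φ x)) := by
    simpa [mul_comm] using integrable_testFn_smul hh.2.1.locallyIntegrableOn hφ1
  have iB : Integrable (fun x => (‖x‖⁻¹ * φ x) * inner ℝ w (k x)) :=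
    integrable_testFn_smul (locallyIntegrableOn_inner hk.2.1.locallyIntegrableOn
      continuous_const) hφ2
  have iA' : Integrable (fun x => f x * (radialDeriv (fun x => inner ℝ w x * ‖x‖⁻¹ * φ x) x +
      ((d : ℝ) - 1) / ‖x‖ * (inner ℝ w x * ‖x‖⁻¹ * φ x))) := by
    refine integrable_smul_of_locallyIntegrableOn hf hφ1.2.1 hφ1.2.2 ?_ fun x hx => ?_
    · simp only [radialDeriv_eq, div_eq_mul_inv]
      have h1 := continuousOn_fderiv_apply_self hφ1.1 (tsupport fun x => inner ℝ w x * ‖x‖⁻¹ * φ x)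
      have h3 := continuousOn_norm_inv hφ1.tsupport_subset_compl
      have h4 := hφ1.1.continuous.continuousOn (s := tsupport fun x => inner ℝ w x * ‖x‖⁻¹ * φ x)
      exact (h3.mul h1).add ((continuousOn_const.mul h3).mul h4)
    · have h0 := image_eq_zero_of_notMem_tsupport hx
      rw [radialDeriv_eq, fderiv_eq_zero_of_notMem_tsupport hx, h0]
      simp
  have iB' := integrable_mul_sphGrad_component hf hφ2 w
  have hset : ∀ u : Euc d → ℝ, (∀ x ∉ tsupport φ, u x = 0) → ∫ x, u x = ∫ x in cBall d, u x :=
    fun u hu => (setIntegral_eq_integral_of_forall_compl_eq_zero fun x hx =>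
      hu x fun h => hx (puncBall_subset_cBall (hφ.2.2 h))).symm
  rw [hset _ fun x hx => by rw [image_eq_zero_of_notMem_tsupport hx, zero_mul],
    hset _ fun x hx => by rw [fderiv_eq_zero_of_notMem_tsupport hx]; simp]
  have e1 : ∫ x in cBall d, φ x * inner ℝ w ((h x * ‖x‖⁻¹) • x + ‖x‖⁻¹ • k x) =
      (∫ x in cBall d, h x * (inner ℝ w x * ‖x‖⁻¹ * φ x)) +
        ∫ x in cBall d, (‖x‖⁻¹ * φ x) * inner ℝ w (k x) := by
    rw [← integral_add iA.integrableOn iB.integrableOn]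
    refine integral_congr_ae (Eventually.of_forall fun x => ?_)
    simp only [inner_add_right, inner_smul_right]
    ring
  rw [e1, eA, eB, ← neg_add, ← integral_add iA'.integrableOn iB'.integrableOn]
  congr 1
  refine setIntegral_cBall_congr hd fun x hx => ?_
  have hx0 : ‖x‖ ≠ 0 := norm_ne_zero_iff.2 hx.2
  have hφd : DifferentiableAt ℝ φ x := hφ.1.differentiable one_ne_zero x
  have hN := hasFDerivAt_norm_inv hx.2
  have hA : HasFDerivAt (fun y : Euc d => inner ℝ w y * ‖y‖⁻¹) _ x :=
    ((innerSL ℝ w).hasFDerivAt (x := x)).mul hN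
  rw [radialDeriv_eq, fderiv_mul_apply hA hφd, fderiv_mul_apply hN hφd, fderiv_mul_apply hN hφd]
  simp [real_inner_comm x w]
  field_simp
  ring

/-- Cauchy–Schwarz for the round metric, multiplied by 1 − |x|² to avoid dividing. As k is
orthogonal to x, only the tangential part of w meets k. -/
theorem inner_weakGradient_sq_le {x k w : Euc d} {h : ℝ} (hx : x ∈ puncBall d)
    (hxk : inner ℝ x k = 0) (hΓ : (1 - ‖x‖ ^ 2) * (h * h) + 1 / ‖x‖ ^ 2 * inner ℝ k k ≤ 1) :
    inner ℝ w ((h * ‖x‖⁻¹) • x + ‖x‖⁻¹ • k) ^ 2 * (1 - ‖x‖ ^ 2) ≤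
      ‖w‖ ^ 2 * (1 - ‖x‖ ^ 2) + inner ℝ x w ^ 2 := by
  have hx0 : ‖x‖ ≠ 0 := norm_ne_zero_iff.2 hx.2
  have hxp := one_sub_norm_sq_pos hx
  set N := ‖x‖⁻¹ with hN
  have hNx : N * ‖x‖ = 1 := inv_mul_cancel₀ hx0
  set c := inner ℝ x w with hc
  set wt : Euc d := w - (N ^ 2 * c) • x with hwt
  have hwk : inner ℝ w k = inner ℝ wt k := by
    rw [hwt, inner_sub_left, real_inner_smul_left, hxk]; simp
  have hN2 : N ^ 2 * ‖x‖ ^ 2 = 1 := by rw [← mul_pow, hNx, one_pow]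
  have hwt2 : ‖wt‖ ^ 2 = ‖w‖ ^ 2 - N ^ 2 * c ^ 2 := by
    rw [hwt, norm_sub_sq_real, inner_smul_right, real_inner_comm, ← hc, norm_smul, mul_pow,
      Real.norm_eq_abs, sq_abs]
    linear_combination N ^ 2 * c ^ 2 * hN2
  have hΓ' : (1 - ‖x‖ ^ 2) * h ^ 2 + N ^ 2 * ‖k‖ ^ 2 ≤ 1 := by
    rw [real_inner_self_eq_norm_sq] at hΓ
    have : 1 / ‖x‖ ^ 2 = N ^ 2 := by rw [hN, inv_pow, one_div]
    rw [this] at hΓ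
    linarith
  rw [inner_add_right, inner_smul_right, inner_smul_right, real_inner_comm, ← hc, hwk]
  set m := inner ℝ wt k
  set A := ‖wt‖
  set B := ‖k‖
  set s := 1 - ‖x‖ ^ 2 with hs
  have hw2 : ‖w‖ ^ 2 * s + c ^ 2 = A ^ 2 * s + N ^ 2 * c ^ 2 := by
    rw [hwt2]
    linear_combination (-c ^ 2) * hN2 - N ^ 2 * c ^ 2 * hs
  rw [hw2]
  have hm : |m| ≤ A * B := abs_real_inner_le_norm _ _
  have h1 : (h * N * c + N * m) ^ 2 ≤ (|h * N * c| + N * (A * B)) ^ 2 := by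
    refine sq_le_sq.2 ((abs_add_le _ _).trans ((?_ : _ ≤ |h * N * c| + N * (A * B)).trans
      (le_abs_self _)))
    rw [abs_mul N m, abs_of_nonneg (by positivity : 0 ≤ N)]
    gcongr
  -- Lagrange's identity for the plane vectors (√s|h|, N‖k‖) and (N|c|, √s A); its left side is the
  -- Cauchy–Schwarz defect.
  have hsq : (|h| * s * A - N ^ 2 * B * |c|) ^ 2 =
      (s * h ^ 2 + N ^ 2 * B ^ 2) * (A ^ 2 * s + N ^ 2 * c ^ 2) -
        (|h * N * c| + N * (A * B)) ^ 2 * s := by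
    rw [abs_mul, abs_mul, abs_of_nonneg (by positivity : 0 ≤ N)]
    linear_combination (s ^ 2 * A ^ 2) * sq_abs h + N ^ 4 * B ^ 2 * sq_abs c +
      s * N ^ 2 * (|c| ^ 2 * sq_abs h + h ^ 2 * sq_abs c)
  have h2 : (h * N * c + N * m) ^ 2 * s ≤ (|h * N * c| + N * (A * B)) ^ 2 * s :=
    mul_le_mul_of_nonneg_right h1 hxp.le
  have h3 : (s * h ^ 2 + N ^ 2 * B ^ 2) * (A ^ 2 * s + N ^ 2 * c ^ 2) ≤
      1 * (A ^ 2 * s + N ^ 2 * c ^ 2) := mul_le_mul_of_nonneg_right hΓ' (by positivity)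
  nlinarith [sq_nonneg (|h| * s * A - N ^ 2 * B * |c|)]

/-- `v` is the distributional gradient of `f` in the punctured ball. -/
def IsWeakGradient (f : Euc d → ℝ) (v : Euc d → Euc d) : Prop :=
  ∀ φ, IsTestFn (puncBall d) φ → ∀ w, ∫ x, φ x * inner ℝ w (v x) = -∫ x, f x * fderiv ℝ φ x w

theorem exists_weakGradient (hd : 2 ≤ d) (hr : ∃ h, HasL2RadialDeriv f h)
    (hs : ∃ k, HasL2SphGrad f k) (hΓ : EnergyLeOne f) :
    ∃ v : Euc d → Euc d, IsWeakGradient f v ∧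
      ∀ᵐ x, x ∈ puncBall d → ∀ w, inner ℝ w (v x) ^ 2 * (1 - ‖x‖ ^ 2) ≤
        ‖w‖ ^ 2 * (1 - ‖x‖ ^ 2) + inner ℝ x w ^ 2 := by
  have hh : HasL2RadialDeriv f (l2RadialDeriv f) := by
    rw [l2RadialDeriv, dif_pos hr]; exact hr.choose_spec
  have hk : HasL2SphGrad f (l2SphGrad f) := by
    rw [l2SphGrad, dif_pos hs]; exact hs.choose_spec
  refine ⟨fun x => (l2RadialDeriv f x * ‖x‖⁻¹) • x + ‖x‖⁻¹ • l2SphGrad f x,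
    fun φ hφ w => integral_weakGradient hd hh hk hφ w, ?_⟩
  filter_upwards [hk.ae_inner_eq_zero hd,
    (ae_restrict_iff' isClosed_closedBall.measurableSet).1 hΓ] with x hx1 hx2 hx w
  exact inner_weakGradient_sq_le hx (hx1 hx) (hx2 (puncBall_subset_cBall hx))

end WeakGradient

/-! ### Lipschitz bound on a conull set by mollification along arcs -/

section Mollification

variable {d : ℕ} {f : Euc d → ℝ} {v : Euc d → Euc d}

/-- A mollification of a function with a bounded weak directional derivative is differentiable with
the same bound. -/
theorem hasFDerivAt_mollification (hf : LocallyIntegrableOn f (puncBall d) volume)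
    (hv : IsWeakGradient f v) (η : ContDiffBump (0 : Euc d)) {K : Set (Euc d)} (hK : IsCompact K)
    (hKU : K ⊆ puncBall d) {x : Euc d} (hx : closedBall x η.rOut ⊆ K) :
    ∃ L : Euc d →L[ℝ] ℝ, HasFDerivAt
      (convolution (η.normed volume) (K.indicator f) (ContinuousLinearMap.lsmul ℝ ℝ) volume) L x ∧
      ∀ w M, (∀ᵐ y, y ∈ closedBall x η.rOut → |inner ℝ w (v y)| ≤ M) → |L w| ≤ M := by
  set ρ := η.normed (volume : Measure (Euc d)) with hρ
  have hρc : HasCompactSupport ρ := η.hasCompactSupport_normed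
  have hρd : ContDiff ℝ 1 ρ := η.contDiff_normed
  have hg : LocallyIntegrable (K.indicator f) volume :=
    ((integrable_indicator_iff hK.measurableSet).2
      (hf.integrableOn_compact_subset hKU hK)).locallyIntegrable
  refine ⟨_, hρc.hasFDerivAt_convolution_left _ hρd hg x, fun w M hM => ?_⟩
  have hint : Integrable (fun t => ContinuousLinearMap.precompL (Euc d)
      (ContinuousLinearMap.lsmul ℝ ℝ) (fderiv ℝ ρ t) (K.indicator f (x - t))) volume :=
    (hρc.fderiv (𝕜 := ℝ)).convolutionExists_left _ (hρd.continuous_fderiv one_ne_zero) hg x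
  rw [convolution_def, ContinuousLinearMap.integral_apply hint]
  -- Reflecting the kernel turns the derivative of the convolution at x into the weak gradient
  -- tested against θ, that is, an average of v with total mass one. Truncating f to K changes
  -- nothing, as θ is supported in K.
  set θ : Euc d → ℝ := fun y => ρ (x - y) with hθ
  have hθd : ContDiff ℝ 1 θ := hρd.comp (contDiff_const.sub contDiff_id)
  have hθ0 : ∀ y ∉ closedBall x η.rOut, θ y = 0 := fun y hy => by
    refine image_eq_zero_of_notMem_tsupport (f := ρ) fun h => hy ?_
    rw [hρ, η.tsupport_normed_eq, mem_closedBall_zero_iff] at h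
    rwa [mem_closedBall, dist_comm, dist_eq_norm]
  have hθs : tsupport θ ⊆ closedBall x η.rOut :=
    closure_minimal (fun y hy => by_contra fun h => hy (hθ0 y h)) isClosed_closedBall
  have hθT : IsTestFn (puncBall d) θ :=
    ⟨hθd, HasCompactSupport.of_support_subset_isCompact (isCompact_closedBall x η.rOut)
      ((subset_tsupport θ).trans hθs), hθs.trans (hx.trans hKU)⟩
  have hθf : ∀ y, fderiv ℝ θ y w = -fderiv ℝ ρ (x - y) w := fun y => by
    have h1 : HasFDerivAt (fun y : Euc d => x - y) (-ContinuousLinearMap.id ℝ (Euc d)) y :=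
      (hasFDerivAt_id y).const_sub x
    have h2 := (hρd.differentiable one_ne_zero (x - y)).hasFDerivAt.comp y h1
    rw [show θ = ρ ∘ fun y => x - y from rfl, h2.fderiv]
    simp
  have e : ∫ t, (ContinuousLinearMap.precompL (Euc d) (ContinuousLinearMap.lsmul ℝ ℝ)
      (fderiv ℝ ρ t) (K.indicator f (x - t))) w = ∫ y, θ y * inner ℝ w (v y) := by
    rw [hv θ hθT w, ← integral_neg, ← integral_sub_left_eq_self _ _ x]
    refine integral_congr_ae (Eventually.of_forall fun y => ?_)
    simp only [sub_sub_cancel, hθf, mul_neg, neg_neg]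
    by_cases hy : y ∈ K
    · simp [hy, mul_comm]
    · have : fderiv ℝ θ y w = 0 := by
        rw [fderiv_eq_zero_of_notMem_tsupport fun h => hy (hx (hθs h))]; rfl
      rw [hθf, neg_eq_zero] at this
      simp [hy, this]
  rw [e]
  have hθi : Integrable θ volume := hθd.continuous.integrable_of_hasCompactSupport hθT.2.1
  have h1 : ∫ y, θ y = 1 := by
    rw [show ∫ y, θ y = ∫ y, ρ y from integral_sub_left_eq_self ρ volume x]
    exact η.integral_normed
  calc |∫ y, θ y * inner ℝ w (v y)| ≤ ∫ y, θ y * M := by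
        rw [← Real.norm_eq_abs]
        refine norm_integral_le_of_norm_le (hθi.mul_const M) ?_
        filter_upwards [hM] with y hy
        by_cases hyb : y ∈ closedBall x η.rOut
        · rw [norm_mul, Real.norm_of_nonneg (η.nonneg_normed _ : 0 ≤ θ y), Real.norm_eq_abs]
          exact mul_le_mul_of_nonneg_left (hy hyb) (η.nonneg_normed _)
        · simp [hθ0 y hyb]
    _ = M := by rw [integral_mul_const, h1, one_mul]

/-- The points of the punctured ball at distance at least `1 / (n + 1)` from the complement. -/
def puncBallExhaustion (d n : ℕ) : Set (Euc d) :=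
  {x | 1 / ((n : ℝ) + 1) ≤ infDist x (puncBall d)ᶜ}

theorem puncBallExhaustion_subset (n : ℕ) : puncBallExhaustion d n ⊆ puncBall d := by
  intro x hx
  by_contra h
  have h0 : infDist x (puncBall d)ᶜ = 0 := infDist_zero_of_mem h
  have : (0 : ℝ) < 1 / ((n : ℝ) + 1) := by positivity
  rw [puncBallExhaustion, mem_ofPred_eq, h0] at hx
  linarith

theorem isCompact_puncBallExhaustion (n : ℕ) : IsCompact (puncBallExhaustion d n) :=
  (isCompact_closedBall (0 : Euc d) 1).of_isClosed_subset
    (isClosed_le continuous_const (continuous_infDist_pt _))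
    ((puncBallExhaustion_subset n).trans puncBall_subset_cBall)

theorem exists_subset_puncBallExhaustion {C : Set (Euc d)} (hC : IsCompact C)
    (hCU : C ⊆ puncBall d) : ∃ n, C ⊆ puncBallExhaustion d n := by
  rcases C.eq_empty_or_nonempty with rfl | hne
  · exact ⟨0, empty_subset _⟩
  obtain ⟨z, hz, hmin⟩ := hC.exists_isMinOn hne
    (continuous_infDist_pt (puncBall d)ᶜ).continuousOn
  have hpos : 0 < infDist z (puncBall d)ᶜ :=
    ((isOpen_puncBall.isClosed_compl).notMem_iff_infDist_pos ⟨0, by simp⟩).1 fun h => h (hCU hz)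
  obtain ⟨n, hn⟩ := exists_nat_one_div_lt hpos
  exact ⟨n, fun x hx => hn.le.trans (hmin hx)⟩

/-- Bump functions supported in balls shrinking to the origin. -/
noncomputable def shrinkingBump (d i : ℕ) : ContDiffBump (0 : Euc d) where
  rIn := 1 / ((i : ℝ) + 1)
  rOut := 2 * (1 / ((i : ℝ) + 1))
  rIn_pos := by positivity
  rIn_lt_rOut := by
    have : (0 : ℝ) < 1 / ((i : ℝ) + 1) := by positivity
    linarith

theorem tendsto_shrinkingBump_rOut :
    Tendsto (fun i => (shrinkingBump d i).rOut) atTop (𝓝 0) := by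
  simpa [shrinkingBump] using tendsto_one_div_add_atTop_nhds_zero_nat.const_mul (2 : ℝ)

/-- Near a unit speed arc the weak gradient is almost bounded by one in the direction of the arc. -/
theorem eventually_inner_le_of_unit_speed {γ γ' : ℝ → Euc d} {T : ℝ} (hγ : Continuous γ)
    (hγ' : Continuous γ') (harc : ∀ t ∈ Icc 0 T, γ t ∈ puncBall d ∧
      ‖γ' t‖ ^ 2 * (1 - ‖γ t‖ ^ 2) + inner ℝ (γ t) (γ' t) ^ 2 = 1 - ‖γ t‖ ^ 2)
    {ε : ℝ} (hε : 0 < ε) : ∀ᶠ u in 𝓝 (0 : Euc d), ∀ t ∈ Icc 0 T,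
      ‖γ' t‖ ^ 2 * (1 - ‖γ t + u‖ ^ 2) + inner ℝ (γ t + u) (γ' t) ^ 2 <
        (1 + ε) ^ 2 * (1 - ‖γ t + u‖ ^ 2) := by
  -- Tube lemma: at u = 0 the inequality is strict because 1 − |γ|² is positive, it is open in (u,
  -- t), and t ranges over a compact interval.
  refine isCompact_Icc.eventually_forall_of_forall_eventually fun t ht => ?_
  have ho : IsOpen {z : Euc d × ℝ |
      ‖γ' z.2‖ ^ 2 * (1 - ‖γ z.2 + z.1‖ ^ 2) + inner ℝ (γ z.2 + z.1) (γ' z.2) ^ 2 <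
        (1 + ε) ^ 2 * (1 - ‖γ z.2 + z.1‖ ^ 2)} :=
    isOpen_lt (by fun_prop) (by fun_prop)
  refine ho.mem_nhds ?_
  obtain ⟨h1, h2⟩ := harc t ht
  have h3 := one_sub_norm_sq_pos h1
  simp only [mem_ofPred_eq, add_zero, h2]
  have h4 : 1 < (1 + ε) ^ 2 := by nlinarith
  nlinarith

/-- Differentiate the mollifications of f along the projected great arc from x to y, apply the mean
value inequality, then let the radius and ε tend to zero. -/
theorem exists_conull_lipschitz_of_linearIndependent
    (hf : LocallyIntegrableOn f (puncBall d) volume) (hv : IsWeakGradient f v)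
    (hb : ∀ᵐ x, x ∈ puncBall d → ∀ w, inner ℝ w (v x) ^ 2 * (1 - ‖x‖ ^ 2) ≤
        ‖w‖ ^ 2 * (1 - ‖x‖ ^ 2) + inner ℝ x w ^ 2) :
    ∃ D ⊆ puncBall d, (∀ᵐ x, x ∈ puncBall d → x ∈ D) ∧ ∀ x ∈ D, ∀ y ∈ D,
      (∀ a b : ℝ, a • x + b • y = 0 → a = 0 ∧ b = 0) → |f y - f x| ≤ ballDist x y := by
  set F : ℕ → ℕ → Euc d → ℝ := fun n i => convolution ((shrinkingBump d i).normed volume)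
    ((puncBallExhaustion d n).indicator f) (ContinuousLinearMap.lsmul ℝ ℝ) volume with hF
  have hae : ∀ᵐ x : Euc d, ∀ n,
      Tendsto (fun i => F n i x) atTop (𝓝 ((puncBallExhaustion d n).indicator f x)) := by
    refine ae_all_iff.2 fun n => ?_
    -- The constant 2 is the fixed ratio of outer to inner radius of the bumps, which Lebesgue
    -- differentiation needs bounded.
    refine ContDiffBump.ae_convolution_tendsto_right_of_locallyIntegrable (K := 2)
      tendsto_shrinkingBump_rOut (Eventually.of_forall fun i => le_rfl) ?_
    exact ((integrable_indicator_iff (isCompact_puncBallExhaustion n).measurableSet).2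
      (hf.integrableOn_compact_subset (puncBallExhaustion_subset n)
        (isCompact_puncBallExhaustion n))).locallyIntegrable
  -- Convergence is required for every exhausting compact set, since the one containing a
  -- neighbourhood of the arc depends on the pair; countably many conditions keep the set conull.
  refine ⟨puncBall d ∩ {x | ∀ n, Tendsto (fun i => F n i x) atTop
    (𝓝 ((puncBallExhaustion d n).indicator f x))}, inter_subset_left, ?_, ?_⟩
  · filter_upwards [hae] with x hx hxU
    exact ⟨hxU, hx⟩
  intro x hx y hy hxy
  obtain ⟨γ, γ', hγ0, hγT, hγ'c, hγd, harc⟩ := exists_unit_speed_arc hx.1 hy.1 hxy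
  set T := ballDist x y with hT
  have hT0 : 0 ≤ T := ballDist_nonneg x y
  have hγc : Continuous γ := continuous_iff_continuousAt.2 fun t => (hγd t).continuousAt
  have hC : IsCompact (γ '' Icc 0 T) := isCompact_Icc.image hγc
  have hCU : γ '' Icc 0 T ⊆ puncBall d := by
    rintro _ ⟨t, ht, rfl⟩
    exact (harc t ht).1
  obtain ⟨δ, hδ, hδU⟩ := hC.exists_cthickening_subset_open isOpen_puncBall hCU
  obtain ⟨n, hn⟩ := exists_subset_puncBallExhaustion hC.cthickening hδU
  have hball : ∀ t ∈ Icc 0 T, ∀ r ≤ δ, closedBall (γ t) r ⊆ puncBallExhaustion d n :=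
    fun t ht r hr => (closedBall_subset_closedBall hr).trans
      ((closedBall_subset_cthickening (mem_image_of_mem γ ht) δ).trans hn)
  have hmem : ∀ t ∈ Icc 0 T, γ t ∈ puncBallExhaustion d n := fun t ht =>
    hball t ht δ le_rfl (mem_closedBall_self hδ.le)
  have hxn : x ∈ puncBallExhaustion d n := hγ0 ▸ hmem 0 ⟨le_rfl, hT0⟩
  have hyn : y ∈ puncBallExhaustion d n := hγT ▸ hmem T ⟨hT0, le_rfl⟩
  have main : ∀ ε > 0, |f y - f x| ≤ (1 + ε) * T := by
    intro ε hε
    obtain ⟨r, hr, hru⟩ := Metric.eventually_nhds_iff.1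
      (eventually_inner_le_of_unit_speed hγc hγ'c harc hε)
    have hlim : Tendsto (fun i => |F n i y - F n i x|) atTop (𝓝 |f y - f x|) := by
      have h1 := hx.2 n
      have h2 := hy.2 n
      rw [indicator_of_mem hxn] at h1
      rw [indicator_of_mem hyn] at h2
      exact (h2.sub h1).abs
    refine le_of_tendsto hlim ?_
    filter_upwards [tendsto_shrinkingBump_rOut.eventually_lt_const (lt_min hr hδ)] with i hi
    have hir : (shrinkingBump d i).rOut < r := hi.trans_le (min_le_left _ _)
    have hiδ : (shrinkingBump d i).rOut ≤ δ := (hi.trans_le (min_le_right _ _)).le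
    have hder : ∀ t ∈ Icc 0 T, ∃ L : ℝ,
        HasDerivAt (fun s => F n i (γ s)) L t ∧ ‖L‖ ≤ 1 + ε := by
      intro t ht
      obtain ⟨L, hL, hLb⟩ := hasFDerivAt_mollification hf hv (shrinkingBump d i)
        (isCompact_puncBallExhaustion n) (puncBallExhaustion_subset n) (hball t ht _ hiδ)
      refine ⟨L (γ' t), hL.comp_hasDerivAt t (hγd t), hLb _ _ ?_⟩
      filter_upwards [hb] with z hz hzb
      have hzU : z ∈ puncBall d := puncBallExhaustion_subset n (hball t ht _ hiδ hzb)
      have h1 := hru (y := z - γ t) (by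
        rw [dist_zero_right, ← dist_eq_norm]; exact (mem_closedBall.1 hzb).trans_lt hir) t ht
      rw [add_sub_cancel] at h1
      have h2 := (hz hzU (γ' t)).trans h1.le
      exact abs_le_of_sq_le_sq (le_of_mul_le_mul_right h2 (one_sub_norm_sq_pos hzU))
        (by positivity)
    choose! L hL hLb using hder
    have := norm_image_sub_le_of_norm_deriv_le_segment' (f := fun s => F n i (γ s)) (f' := L)
      (C := 1 + ε) (a := 0) (b := T) (fun t ht => (hL t ht).hasDerivWithinAt)
      (fun t ht => hLb t (Ico_subset_Icc_self ht)) T ⟨hT0, le_rfl⟩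
    simpa [hγ0, hγT] using this
  have hlim : Tendsto (fun ε : ℝ => (1 + ε) * T) (𝓝[>] 0) (𝓝 T) := by
    have h : Tendsto (fun ε : ℝ => (1 + ε) * T) (𝓝 0) (𝓝 ((1 + 0) * T)) :=
      Continuous.tendsto (by fun_prop) 0
    simpa using h.mono_left nhdsWithin_le_nhds
  exact ge_of_tendsto hlim (eventually_nhdsWithin_of_forall fun ε hε => main ε hε)

/-- If x and y lie on one line through the origin, a point z of the good set off that line is
independent of both. The line is null since d ≥ 2, so z can tend to y, and the bound through z tends
to `ballDist x y`. -/
theorem exists_conull_lipschitz (hd : 2 ≤ d)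
    (hf : LocallyIntegrableOn f (puncBall d) volume) (hv : IsWeakGradient f v)
    (hb : ∀ᵐ x, x ∈ puncBall d → ∀ w, inner ℝ w (v x) ^ 2 * (1 - ‖x‖ ^ 2) ≤
        ‖w‖ ^ 2 * (1 - ‖x‖ ^ 2) + inner ℝ x w ^ 2) :
    ∃ D ⊆ puncBall d, (∀ᵐ x, x ∈ puncBall d → x ∈ D) ∧ ∀ x ∈ D, ∀ y ∈ D,
      |f y - f x| ≤ ballDist x y := by
  obtain ⟨D, hDU, hDae, hD⟩ := exists_conull_lipschitz_of_linearIndependent hf hv hb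
  refine ⟨D, hDU, hDae, fun x hx y hy => ?_⟩
  by_cases hxy : ∀ a b : ℝ, a • x + b • y = 0 → a = 0 ∧ b = 0
  · exact hD x hx y hy hxy
  have hx0 : x ≠ 0 := (hDU hx).2
  have hy0 : y ≠ 0 := (hDU hy).2
  have hyS : y ∈ Submodule.span ℝ {x} := by
    push Not at hxy
    obtain ⟨a, b, hab, hne⟩ := hxy
    have hb0 : b ≠ 0 := by
      rintro rfl
      have : a = 0 := by simpa [hx0] using hab
      exact hne this rfl
    refine Submodule.mem_span_singleton.2 ⟨-(b⁻¹ * a), ?_⟩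
    have h : b • y = -(a • x) := eq_neg_of_add_eq_zero_right hab
    rw [neg_smul, mul_smul, ← smul_neg, ← h, inv_smul_smul₀ hb0]
  have hind : ∀ u ∈ Submodule.span ℝ {x}, u ≠ 0 → ∀ z ∉ Submodule.span ℝ {x},
      ∀ a b : ℝ, a • u + b • z = 0 → a = 0 ∧ b = 0 := by
    intro u hu hu0 z hz a b hab
    have hb0 : b = 0 := by
      by_contra hb0
      have h : b • z = -(a • u) := eq_neg_of_add_eq_zero_right hab
      refine hz ?_
      rw [← inv_smul_smul₀ hb0 z, h]
      exact Submodule.smul_mem _ _ (neg_mem (Submodule.smul_mem _ _ hu))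
    subst hb0
    exact ⟨by simpa [hu0] using hab, rfl⟩
  have hSnull : ∀ᵐ z : Euc d, z ∉ Submodule.span ℝ {x} := by
    refine measure_eq_zero_iff_ae_notMem.1 (Measure.addHaar_submodule volume _ fun h => ?_)
    have h1 := finrank_span_singleton (K := ℝ) hx0
    rw [h, finrank_top, finrank_euclideanSpace_fin] at h1
    omega
  have hdense : Dense {z : Euc d | (z ∈ puncBall d → z ∈ D) ∧ z ∉ Submodule.span ℝ {x}} :=
    Measure.dense_of_ae (hDae.and hSnull)
  have hU : ∀ᶠ z in 𝓝 y, z ∈ puncBall d := isOpen_puncBall.eventually_mem (hDU hy)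
  have hfreq : ∃ᶠ z in 𝓝 y, ((z ∈ puncBall d → z ∈ D) ∧ z ∉ Submodule.span ℝ {x}) ∧
      z ∈ puncBall d := (mem_closure_iff_frequently.1 (hdense y)).and_eventually hU
  have hlim : Tendsto (fun z => ballDist x z + ballDist z y) (𝓝 y) (𝓝 (ballDist x y)) := by
    have h : Continuous fun z => ballDist x z + ballDist z y := by fun_prop
    have := h.tendsto y
    rwa [ballDist_self (puncBall_subset_cBall (hDU hy)), add_zero] at this
  refine ge_of_tendsto_of_frequently hlim (hfreq.mono fun z hz => ?_)
  have hzD := hz.1.1 hz.2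
  have h1 := hD x hx z hzD (hind x (Submodule.mem_span_singleton_self x) hx0 z hz.1.2)
  have h2 := hD y hy z hzD (hind y hyS hy0 z hz.1.2)
  rw [ballDist_comm y z] at h2
  calc |f y - f x| ≤ |f y - f z| + |f z - f x| := abs_sub_le _ _ _
    _ ≤ ballDist x z + ballDist z y := by rw [abs_sub_comm (f y)]; linarith

end Mollification

/-! ### Extension to the closed ball -/

section Extension

variable {d : ℕ} {f g : Euc d → ℝ}

theorem continuousOn_of_abs_sub_le_ballDist
    (hg : ∀ x ∈ cBall d, ∀ y ∈ cBall d, |g x - g y| ≤ ballDist x y) :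
    ContinuousOn g (cBall d) := by
  intro x hx
  rw [ContinuousWithinAt, tendsto_iff_dist_tendsto_zero]
  have hlim : Tendsto (fun y => ballDist y x) (𝓝[cBall d] x) (𝓝 0) := by
    have h : Continuous fun y => ballDist y x := by fun_prop
    have := (h.tendsto x).mono_left (nhdsWithin_le_nhds (s := cBall d))
    rwa [ballDist_self hx] at this
  refine squeeze_zero' (Eventually.of_forall fun _ => dist_nonneg) ?_ hlim
  filter_upwards [self_mem_nhdsWithin] with y hy
  rw [Real.dist_eq]
  exact hg y hy x hx

/-- McShane extension with respect to the geodesic distance of the ball. -/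
theorem exists_lipschitz_extension {D : Set (Euc d)} (hDB : D ⊆ cBall d)
    (hD : ∀ x ∈ D, ∀ y ∈ D, |f y - f x| ≤ ballDist x y) :
    ∃ g : Euc d → ℝ, (∀ x ∈ D, f x = g x) ∧
      ∀ x ∈ cBall d, ∀ y ∈ cBall d, |g x - g y| ≤ ballDist x y := by
  rcases D.eq_empty_or_nonempty with rfl | ⟨z₀, hz₀⟩
  · exact ⟨0, by simp, fun x _ y _ => by simpa using ballDist_nonneg x y⟩
  have : Nonempty D := ⟨⟨z₀, hz₀⟩⟩
  set g : Euc d → ℝ := fun x => ⨅ z : D, (f z + ballDist x z)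
  have hbdd : ∀ x, BddBelow (range fun z : D => f z + ballDist x (z : Euc d)) := fun x => by
    -- The infimum is finite because geodesic distances never exceed π.
    refine ⟨f z₀ - Real.pi, forall_mem_range.2 fun z => ?_⟩
    have h1 := (abs_le.1 (hD z z.2 z₀ hz₀)).2
    have h2 : ballDist (z : Euc d) z₀ ≤ Real.pi := Real.arccos_le_pi _
    have h3 := ballDist_nonneg x (z : Euc d)
    linarith
  have hle : ∀ x ∈ cBall d, ∀ y ∈ cBall d, g x - ballDist x y ≤ g y := fun x hx y hy => by
    refine le_ciInf fun z => ?_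
    have h1 : g x ≤ f z + ballDist x z := ciInf_le (hbdd x) z
    have h2 := ballDist_triangle hx hy (hDB z.2)
    linarith
  refine ⟨g, fun x hx => le_antisymm ?_ ?_, fun x hx y hy => ?_⟩
  · refine le_ciInf fun z => ?_
    have h1 := (abs_le.1 (hD z z.2 x hx)).2
    rw [ballDist_comm x]
    linarith
  · have h1 : g x ≤ f x + ballDist x x := ciInf_le (hbdd x) (⟨x, hx⟩ : D)
    rwa [ballDist_self (hDB hx), add_zero] at h1
  · have h1 := hle x hx y hy
    have h2 := hle y hy x hx
    rw [ballDist_comm y x] at h2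
    exact abs_le.2 ⟨by linarith, by linarith⟩

theorem exists_lipschitz_representative (hd : 2 ≤ d) (hr : ∃ h, HasL2RadialDeriv f h)
    (hs : ∃ k, HasL2SphGrad f k) (hΓ : EnergyLeOne f) :
    ∃ g : Euc d → ℝ, ContinuousOn g (cBall d) ∧
      (∀ᵐ x ∂(volume.restrict (cBall d)), f x = g x) ∧
      ∀ x ∈ cBall d, ∀ y ∈ cBall d, |g x - g y| ≤ ballDist x y := by
  obtain ⟨v, hv, hb⟩ := exists_weakGradient hd hr hs hΓ
  obtain ⟨D, hDU, hDae, hD⟩ :=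
    exists_conull_lipschitz hd hr.choose_spec.1.locallyIntegrableOn hv hb
  obtain ⟨g, hgD, hg⟩ := exists_lipschitz_extension (hDU.trans puncBall_subset_cBall) hD
  refine ⟨g, continuousOn_of_abs_sub_le_ballDist hg, ?_, hg⟩
  filter_upwards [ae_mem_puncBall hd, ae_restrict_of_ae hDae] with x hx hxD
  exact hgD x (hxD hx)

end Extension

/-! ### Transfer to the hemisphere -/

section Hemisphere

variable {d : ℕ}

/-- The projection forgetting the last coordinate, as a continuous linear map. -/
noncomputable def dropLastCLM (d : ℕ) : Euc (d + 1) →L[ℝ] Euc d :=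
  LinearMap.toContinuousLinearMap
    { toFun := dropLast
      map_add' := fun x y => by ext i; simp [dropLast]
      map_smul' := fun c x => by ext i; simp [dropLast] }

theorem dropLastCLM_apply (ξ : Euc (d + 1)) : dropLastCLM d ξ = dropLast ξ := rfl

theorem dropLastCLM_surjective : Function.Surjective (dropLastCLM d) := fun y =>
  ⟨WithLp.toLp 2 (Fin.snoc (α := fun _ => ℝ) y 0), by ext i; simp [dropLastCLM_apply, dropLast]⟩

theorem inner_eq_inner_dropLast_add (ξ ζ : Euc (d + 1)) :
    inner ℝ ξ ζ = inner ℝ (dropLast ξ) (dropLast ζ) + ξ (Fin.last d) * ζ (Fin.last d) := by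
  simp [PiLp.inner_apply, Fin.sum_univ_castSucc, dropLast, mul_comm]

theorem norm_sq_eq_norm_dropLast_sq_add (ξ : Euc (d + 1)) :
    ‖ξ‖ ^ 2 = ‖dropLast ξ‖ ^ 2 + ξ (Fin.last d) ^ 2 := by
  rw [← real_inner_self_eq_norm_sq, inner_eq_inner_dropLast_add, real_inner_self_eq_norm_sq, sq (ξ _)]

theorem dropLast_mem_cBall {ξ : Euc (d + 1)} (hξ : ‖ξ‖ = 1) : dropLast ξ ∈ cBall d := by
  have h := norm_sq_eq_norm_dropLast_sq_add ξ
  rw [hξ] at h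
  rw [mem_closedBall_zero_iff]
  nlinarith [norm_nonneg (dropLast ξ), sq_nonneg (ξ (Fin.last d))]

theorem sqrt_one_sub_norm_dropLast {ξ : Euc (d + 1)} (hξ : ξ ∈ hemisphere d) :
    √(1 - ‖dropLast ξ‖ ^ 2) = ξ (Fin.last d) := by
  have h := norm_sq_eq_norm_dropLast_sq_add ξ
  rw [hξ.1] at h
  rw [show 1 - ‖dropLast ξ‖ ^ 2 = ξ (Fin.last d) ^ 2 by linarith, Real.sqrt_sq hξ.2]

theorem ballDist_dropLast {ξ ζ : Euc (d + 1)} (hξ : ξ ∈ hemisphere d) (hζ : ζ ∈ hemisphere d) :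
    ballDist (dropLast ξ) (dropLast ζ) = geoDist ξ ζ := by
  rw [ballDist, geoDist, sqrt_one_sub_norm_dropLast hξ, sqrt_one_sub_norm_dropLast hζ,
    inner_eq_inner_dropLast_add]

theorem measurable_dropLast : Measurable (dropLast : Euc (d + 1) → Euc d) :=
  (dropLastCLM d).continuous.measurable

theorem volume_preimage_dropLast {N : Set (Euc d)} (hNm : MeasurableSet N) (hN : volume N = 0) :
    volume (dropLast ⁻¹' N : Set (Euc (d + 1))) = 0 := by
  have := (ae_comp_linearMap_mem_iff (dropLastCLM d : Euc (d + 1) →ₗ[ℝ] Euc d) volume volume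
    dropLastCLM_surjective hNm.compl).2 (measure_eq_zero_iff_ae_notMem.1 hN)
  exact measure_eq_zero_iff_ae_notMem.2 this

/-- Conical coordinates: `(x, r) ↦ r (x, √(1 - |x|²))`. -/
noncomputable def hemisphereCone (z : Euc (d + 1)) : Euc (d + 1) :=
  z (Fin.last d) • (z + (√(1 - ‖dropLast z‖ ^ 2) - z (Fin.last d)) •
    EuclideanSpace.single (Fin.last d) (1 : ℝ))

theorem differentiableOn_hemisphereCone :
    DifferentiableOn ℝ (hemisphereCone (d := d)) (dropLast ⁻¹' ball (0 : Euc d) 1) := by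
  intro z hz
  have h1 : DifferentiableAt ℝ (fun z : Euc (d + 1) => z (Fin.last d)) z :=
    (EuclideanSpace.proj (Fin.last d) : Euc (d + 1) →L[ℝ] ℝ).differentiableAt
  have h2 : DifferentiableAt ℝ (fun z : Euc (d + 1) => dropLast z) z :=
    (dropLastCLM d).differentiableAt
  have hz1 : ‖dropLast z‖ < 1 := mem_ball_zero_iff.1 hz
  have h3 : 1 - ‖dropLast z‖ ^ 2 ≠ 0 := by nlinarith [norm_nonneg (dropLast z)]
  have h4 : DifferentiableAt ℝ (fun z : Euc (d + 1) => √(1 - ‖dropLast z‖ ^ 2)) z :=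
    ((h2.norm_sq ℝ).const_sub 1).sqrt h3
  exact (h1.smul (differentiableAt_id.add ((h4.sub h1).smul_const _))).differentiableWithinAt

/-- Replacing the last coordinate of ξ by r gives the conical coordinates of rξ, so the cone over a
piece of the hemisphere is an image of a cylinder. -/
theorem hemisphereCone_apply {ξ : Euc (d + 1)} (hξ : ξ ∈ hemisphere d) (r : ℝ) :
    dropLast (ξ + (r - ξ (Fin.last d)) • EuclideanSpace.single (Fin.last d) (1 : ℝ)) =
      dropLast ξ ∧
    hemisphereCone (ξ + (r - ξ (Fin.last d)) • EuclideanSpace.single (Fin.last d) (1 : ℝ)) =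
      r • ξ := by
  have h1 : dropLast (ξ + (r - ξ (Fin.last d)) • EuclideanSpace.single (Fin.last d) (1 : ℝ)) =
      dropLast ξ := by
    ext i
    simp [dropLast]
  refine ⟨h1, ?_⟩
  rw [hemisphereCone, h1, sqrt_one_sub_norm_dropLast hξ, add_assoc, ← add_smul]
  simp

/-- The part of the hemisphere above a null set of the ball has area zero. -/
theorem areaMeasure_hemisphere_preimage_eq_zero {N : Set (Euc d)} (hNm : MeasurableSet N)
    (hN : volume N = 0) :
    areaMeasure d {ξ | (ξ : Euc (d + 1)) ∈ hemisphere d ∧ dropLast (ξ : Euc (d + 1)) ∈ N} = 0 := by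
  have hlast : Measurable fun z : Euc (d + 1) => z (Fin.last d) :=
    (EuclideanSpace.proj (Fin.last d) : Euc (d + 1) →L[ℝ] ℝ).continuous.measurable
  have hm : MeasurableSet {ξ : sphere (0 : Euc (d + 1)) 1 |
      (ξ : Euc (d + 1)) ∈ hemisphere d ∧ dropLast (ξ : Euc (d + 1)) ∈ N} := by
    refine measurable_subtype_coe (t := hemisphere d ∩ dropLast ⁻¹' N) ?_
    refine MeasurableSet.inter ?_ (measurable_dropLast hNm)
    exact (measurableSet_eq_fun measurable_norm measurable_const).inter
      (measurableSet_le measurable_const hlast)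
  -- Area is, up to a dimensional factor, the volume of the cone over the set.
  rw [Measure.toSphere_apply' _ hm]
  refine mul_eq_zero_of_right _ ?_
  have hker : volume ((LinearMap.ker (EuclideanSpace.proj (Fin.last d) :
      Euc (d + 1) →L[ℝ] ℝ).toLinearMap : Submodule ℝ (Euc (d + 1))) : Set (Euc (d + 1))) = 0 := by
    refine Measure.addHaar_submodule _ _ fun h => ?_
    have : EuclideanSpace.single (Fin.last d) (1 : ℝ) ∈ LinearMap.ker
      (EuclideanSpace.proj (Fin.last d) : Euc (d + 1) →L[ℝ] ℝ).toLinearMap :=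
      h ▸ Submodule.mem_top
    simp at this
  have himg : volume (hemisphereCone (d := d) '' (dropLast ⁻¹' (N ∩ ball 0 1))) = 0 := by
    refine addHaar_image_eq_zero_of_differentiableOn_of_addHaar_eq_zero _
      (differentiableOn_hemisphereCone.mono fun z hz => hz.2)
      (volume_preimage_dropLast (hNm.inter isOpen_ball.measurableSet)
        (measure_mono_null inter_subset_left hN))
  -- Equatorial points have their cone in a hyperplane. The rest of the cone is the image of a null
  -- cylinder under a map differentiable where |x| < 1, and such images are null.
  refine measure_mono_null ?_ (measure_union_null hker himg)
  rintro _ ⟨r, -, _, ⟨ξ, ⟨hξ, hξN⟩, rfl⟩, rfl⟩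
  rcases hξ.2.eq_or_lt with h0 | h0
  · left
    simp [← h0]
  · right
    obtain ⟨h1, h2⟩ := hemisphereCone_apply hξ r
    refine ⟨_, ?_, h2⟩
    rw [mem_preimage, h1]
    refine ⟨hξN, ?_⟩
    have h := norm_sq_eq_norm_dropLast_sq_add (ξ : Euc (d + 1))
    rw [hξ.1] at h
    rw [mem_ball_zero_iff]
    nlinarith [norm_nonneg (dropLast (ξ : Euc (d + 1)))]

theorem exists_lipschitz_hemisphere_representative {f g : Euc d → ℝ}
    (hgc : ContinuousOn g (cBall d)) (hfg : ∀ᵐ x ∂(volume.restrict (cBall d)), f x = g x)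
    (hg : ∀ x ∈ cBall d, ∀ y ∈ cBall d, |g x - g y| ≤ ballDist x y) :
    ∃ F : Euc (d + 1) → ℝ, ContinuousOn F (hemisphere d) ∧
      (∀ᵐ ξ : sphere (0 : Euc (d + 1)) 1 ∂(areaMeasure d),
        (ξ : Euc (d + 1)) ∈ hemisphere d → F ξ = f (dropLast (ξ : Euc (d + 1)))) ∧
      ∀ ξ ∈ hemisphere d, ∀ ζ ∈ hemisphere d, |F ξ - F ζ| ≤ geoDist ξ ζ := by
  refine ⟨fun ξ => g (dropLast ξ), hgc.comp (dropLastCLM d).continuous.continuousOn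
    fun ξ hξ => dropLast_mem_cBall hξ.1, ?_, fun ξ hξ ζ hζ => ?_⟩
  · have h0 : volume {x | ¬ (x ∈ cBall d → f x = g x)} = 0 :=
      ae_iff.1 ((ae_restrict_iff' isClosed_closedBall.measurableSet).1 hfg)
    -- The exceptional set need not be measurable, so its measurable hull is used.
    have h1 := areaMeasure_hemisphere_preimage_eq_zero (measurableSet_toMeasurable volume _)
      ((measure_toMeasurable _).trans h0)
    filter_upwards [measure_eq_zero_iff_ae_notMem.1 h1] with ξ hξ hξh
    by_contra hne
    refine hξ ⟨hξh, subset_toMeasurable _ _ fun h => hne ?_⟩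
    exact (h (dropLast_mem_cBall hξh.1)).symm
  · rw [← ballDist_dropLast hξ hζ]
    exact hg _ (dropLast_mem_cBall hξ.1) _ (dropLast_mem_cBall hζ.1)

end Hemisphere

/-! ### Classical derivatives are `L²` derivatives -/

section ClassicalDerivatives

variable {d : ℕ} {f φ : Euc d → ℝ}

theorem isL2Loc_of_continuousOn {F : Type*} [NormedAddCommGroup F] {k : Euc d → F}
    (hk : ContinuousOn k (puncBall d)) : IsL2Loc (puncBall d) k := by
  intro K hK hKU
  have : IsFiniteMeasure (volume.restrict K) := ⟨by simpa using hK.measure_lt_top⟩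
  obtain ⟨C, hC⟩ := hK.exists_bound_of_continuousOn (hk.mono hKU)
  refine MemLp.of_bound ?_ C ?_
  · exact (hk.mono hKU).aestronglyMeasurable_of_isCompact hK hK.measurableSet
  · filter_upwards [ae_restrict_mem hK.measurableSet] with x hx using hC x hx

theorem continuousOn_fderiv_of_contDiffOn (hf : ContDiffOn ℝ 1 f (puncBall d)) :
    ContinuousOn (fun x => fderiv ℝ f x) (puncBall d) :=
  hf.continuousOn_fderiv_of_isOpen isOpen_puncBall le_rfl

theorem locallyIntegrableOn_fderiv_apply (hf : ContDiffOn ℝ 1 f (puncBall d)) (w : Euc d) :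
    LocallyIntegrableOn (fun x => fderiv ℝ f x w) (puncBall d) volume :=
  ((continuousOn_fderiv_of_contDiffOn hf).clm_apply continuousOn_const).locallyIntegrableOn
    isOpen_puncBall.measurableSet

theorem integral_mul_fderiv_testFn (hf : ContDiffOn ℝ 1 f (puncBall d))
    (hφ : IsTestFn (puncBall d) φ) (w : Euc d) :
    ∫ x, φ x * fderiv ℝ f x w = -∫ x, f x * fderiv ℝ φ x w := by
  have hfl : LocallyIntegrableOn f (puncBall d) volume :=
    hf.continuousOn.locallyIntegrableOn isOpen_puncBall.measurableSet
  have h1 : Integrable (fun x => fderiv ℝ f x w * φ x) := by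
    simpa [mul_comm] using integrable_testFn_smul (locallyIntegrableOn_fderiv_apply hf w) hφ
  have h2 : Integrable (fun x => f x * fderiv ℝ φ x w) :=
    integrable_smul_of_locallyIntegrableOn hfl hφ.2.1 hφ.2.2
      (continuousOn_fderiv_apply hφ.1 w _) fun x hx => by
        rw [fderiv_eq_zero_of_notMem_tsupport hx]; rfl
  have h3 : Integrable (fun x => f x * φ x) := by
    simpa [mul_comm] using integrable_testFn_smul hfl hφ
  rw [integral_mul_fderiv_eq_neg_fderiv_mul_of_integrable h1 h2 h3, neg_neg]
  · simp only [mul_comm]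
  · exact fun x hx => (hf.contDiffAt (isOpen_puncBall.mem_nhds (hφ.2.2 hx))).differentiableAt
      one_ne_zero
  · exact fun x _ => hφ.1.differentiable one_ne_zero x

theorem setIntegral_cBall_eq_integral {u : Euc d → ℝ} (hφ : IsTestFn (puncBall d) φ)
    (hu : ∀ x ∉ tsupport φ, u x = 0) : ∫ x in cBall d, u x = ∫ x, u x :=
  setIntegral_eq_integral_of_forall_compl_eq_zero fun x hx =>
    hu x fun h => hx (puncBall_subset_cBall (hφ.2.2 h))

theorem setIntegral_mul_fderiv_testFn (hf : ContDiffOn ℝ 1 f (puncBall d))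
    (hφ : IsTestFn (puncBall d) φ) (w : Euc d) :
    ∫ x in cBall d, φ x * fderiv ℝ f x w = -∫ x in cBall d, f x * fderiv ℝ φ x w := by
  rw [setIntegral_cBall_eq_integral hφ fun x hx => by
      rw [image_eq_zero_of_notMem_tsupport hx, zero_mul],
    setIntegral_cBall_eq_integral hφ fun x hx => by
      rw [fderiv_eq_zero_of_notMem_tsupport hx]; simp]
  exact integral_mul_fderiv_testFn hf hφ w

theorem integrable_mul_fderiv_testFn (hf : ContDiffOn ℝ 1 f (puncBall d))
    (hφ : IsTestFn (puncBall d) φ) (w : Euc d) : Integrable (fun x => φ x * fderiv ℝ f x w) :=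
  integrable_testFn_smul (locallyIntegrableOn_fderiv_apply hf w) hφ

theorem integrable_mul_fderiv_testFn' (hf : ContDiffOn ℝ 1 f (puncBall d))
    (hφ : IsTestFn (puncBall d) φ) (w : Euc d) : Integrable (fun x => f x * fderiv ℝ φ x w) :=
  integrable_smul_of_locallyIntegrableOn
    (hf.continuousOn.locallyIntegrableOn isOpen_puncBall.measurableSet) hφ.2.1 hφ.2.2
    (continuousOn_fderiv_apply hφ.1 w _) fun x hx => by
      rw [fderiv_eq_zero_of_notMem_tsupport hx]; rfl

/-- Integration by parts along the field x/|x|, whose divergence is (d − 1)/|x|; each coordinate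
uses the test function xⱼ|x|⁻¹φ. -/
theorem setIntegral_radialDeriv_mul (hd : 2 ≤ d) (hf : ContDiffOn ℝ 1 f (puncBall d))
    (hφ : IsTestFn (puncBall d) φ) :
    ∫ x in cBall d, radialDeriv f x * φ x =
      -∫ x in cBall d, f x * (radialDeriv φ x + ((d : ℝ) - 1) / ‖x‖ * φ x) := by
  set e : Fin d → Euc d := fun j => EuclideanSpace.single j (1 : ℝ)
  have he : ∀ (j : Fin d) (x : Euc d), inner ℝ (e j) x = x j := fun j x => by
    simp [e, EuclideanSpace.inner_single_left]
  have hT : ∀ j, IsTestFn (puncBall d) (fun x => (inner ℝ (e j) x * ‖x‖⁻¹) * φ x) := fun j =>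
    hφ.mul_left ((contDiffOn_inner_left _ _).mul contDiffOn_norm_inv)
  have h1 : ∫ x in cBall d, radialDeriv f x * φ x =
      ∫ x in cBall d, ∑ j, ((inner ℝ (e j) x * ‖x‖⁻¹) * φ x) * fderiv ℝ f x (e j) := by
    refine integral_congr_ae (Eventually.of_forall fun x => ?_)
    simp only [he, radialDeriv, Finset.sum_mul, e]
    refine Finset.sum_congr rfl fun j _ => ?_
    rw [div_eq_mul_inv]
    ring
  rw [h1, integral_finsetSum _ fun j _ =>
    (integrable_mul_fderiv_testFn hf (hT j) (e j)).integrableOn]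
  simp_rw [setIntegral_mul_fderiv_testFn hf (hT _) _]
  rw [Finset.sum_neg_distrib, ← integral_finsetSum _ fun j _ =>
    (integrable_mul_fderiv_testFn' hf (hT j) (e j)).integrableOn]
  congr 1
  refine setIntegral_cBall_congr hd fun x hx => ?_
  have hx0 : ‖x‖ ≠ 0 := norm_ne_zero_iff.2 hx.2
  have hφd : DifferentiableAt ℝ φ x := hφ.1.differentiable one_ne_zero x
  have hD : ∀ j, fderiv ℝ (fun y => (inner ℝ (e j) y * ‖y‖⁻¹) * φ y) x (e j) =
      (‖x‖⁻¹ - ‖x‖⁻¹ ^ 3 * (x j * x j)) * φ x + ‖x‖⁻¹ * (x j * fderiv ℝ φ x (e j)) := fun j => by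
    have hA : HasFDerivAt (fun y : Euc d => inner ℝ (e j) y * ‖y‖⁻¹) _ x :=
      ((innerSL ℝ (e j)).hasFDerivAt (x := x)).mul (hasFDerivAt_norm_inv hx.2)
    have hej : ‖e j‖ = 1 := by simp [e]
    have hxe : inner ℝ x (e j) = x j := by rw [real_inner_comm, he]
    rw [fderiv_mul_apply hA hφd]
    simp [he, hej, hxe]
    ring
  simp only [hD]
  have hs : ∑ j, x j * x j = ‖x‖ ^ 2 := by
    rw [EuclideanSpace.real_norm_sq_eq]
    simp [pow_two]
  have hs1 : ∑ j, x j * fderiv ℝ φ x (e j) = fderiv ℝ φ x x := sum_mul_clm_single _ _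
  rw [← Finset.mul_sum, Finset.sum_add_distrib, ← Finset.mul_sum, hs1, ← Finset.sum_mul,
    Finset.sum_sub_distrib, ← Finset.mul_sum, hs, radialDeriv_eq]
  simp
  field_simp
  left
  ring

theorem contDiffOn_norm : ContDiffOn ℝ 1 (fun y : Euc d => ‖y‖) {0}ᶜ := fun _ hx =>
  (contDiffAt_norm ℝ hx).contDiffWithinAt

theorem hasFDerivAt_norm {x : Euc d} (hx : x ≠ 0) :
    HasFDerivAt (fun y : Euc d => ‖y‖) (‖x‖⁻¹ • innerSL ℝ x) x := by
  have hn : ‖x‖ ≠ 0 := norm_ne_zero_iff.2 hx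
  have h1 := (hasStrictFDerivAt_norm_sq x).hasFDerivAt.sqrt (pow_ne_zero 2 hn)
  simp only [Real.sqrt_sq (norm_nonneg _)] at h1
  refine h1.congr_fderiv ?_
  ext v
  simp
  field_simp

theorem continuousOn_radialDeriv (hf : ContDiffOn ℝ 1 f (puncBall d)) :
    ContinuousOn (radialDeriv f) (puncBall d) := by
  have h1 := continuousOn_fderiv_of_contDiffOn hf
  have h3 : ContinuousOn (fun x : Euc d => ‖x‖⁻¹) (puncBall d) :=
    continuousOn_norm_inv fun _ hx => hx.2
  exact (h3.mul (h1.clm_apply continuousOn_id)).congr fun x _ => radialDeriv_eq f x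

theorem continuousOn_sphGrad (hf : ContDiffOn ℝ 1 f (puncBall d)) :
    ContinuousOn (sphGrad f) (puncBall d) := by
  have h5 : ContinuousOn (fun x => gradient f x) (puncBall d) :=
    ((InnerProductSpace.toDual ℝ (Euc d)).symm.continuous).comp_continuousOn
      (continuousOn_fderiv_of_contDiffOn hf)
  exact (continuous_norm.continuousOn.smul h5).sub
    ((continuousOn_radialDeriv hf).smul continuousOn_id)

theorem hasL2RadialDeriv_of_contDiffOn (hd : 2 ≤ d) (hf : ContDiffOn ℝ 1 f (puncBall d)) :
    HasL2RadialDeriv f (radialDeriv f) :=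
  ⟨isL2Loc_of_continuousOn hf.continuousOn, isL2Loc_of_continuousOn (continuousOn_radialDeriv hf),
    fun _ hφ => setIntegral_radialDeriv_mul hd hf hφ⟩

/-- The component along w is |x|∂_w f − ⟨w, x⟩∂_r f. Integrating by parts against |x|φ and ⟨w, x⟩φ,
the terms ⟨w, x⟩φ/|x| from differentiating the factors cancel, leaving the divergence term of ∂_r.
-/
theorem hasL2SphGrad_of_contDiffOn (hd : 2 ≤ d) (hf : ContDiffOn ℝ 1 f (puncBall d)) :
    HasL2SphGrad f (sphGrad f) := by
  have hk := isL2Loc_of_continuousOn (continuousOn_sphGrad hf)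
  have hf2 := isL2Loc_of_continuousOn hf.continuousOn
  have hfl := hf2.locallyIntegrableOn
  refine ⟨hf2, hk, fun φ hφ => ext_inner_left ℝ fun w => ?_⟩
  have i1 := integrable_testFn_smul hk.locallyIntegrableOn hφ
  have i2 := integrable_smul_sphGrad_testFn hfl hφ
  rw [inner_neg_right, ← integral_inner i1.integrableOn, ← integral_inner i2.integrableOn]
  have hφ1 := hφ.mul_left contDiffOn_norm
  have hφ2 := hφ.mul_left (contDiffOn_inner_left w _)
  have eA := setIntegral_mul_fderiv_testFn hf hφ1 w
  have eB := setIntegral_radialDeriv_mul hd hf hφ2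
  have iA := integrable_mul_fderiv_testFn hf hφ1 w
  have iA' := integrable_mul_fderiv_testFn' hf hφ1 w
  have iB : Integrable (fun x => radialDeriv f x * (inner ℝ w x * φ x)) := by
    simpa [mul_comm] using integrable_testFn_smul
      (isL2Loc_of_continuousOn (continuousOn_radialDeriv hf)).locallyIntegrableOn hφ2
  have iB' : Integrable (fun x => f x * (radialDeriv (fun x => inner ℝ w x * φ x) x +
      ((d : ℝ) - 1) / ‖x‖ * (inner ℝ w x * φ x))) := by
    refine integrable_smul_of_locallyIntegrableOn hfl hφ2.2.1 hφ2.2.2 ?_ fun x hx => ?_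
    · simp only [radialDeriv_eq, div_eq_mul_inv]
      have h1 := continuousOn_fderiv_apply_self hφ2.1 (tsupport fun x => inner ℝ w x * φ x)
      have h3 := continuousOn_norm_inv hφ2.tsupport_subset_compl
      have h4 := hφ2.1.continuous.continuousOn (s := tsupport fun x => inner ℝ w x * φ x)
      exact (h3.mul h1).add ((continuousOn_const.mul h3).mul h4)
    · have h0 := image_eq_zero_of_notMem_tsupport hx
      rw [radialDeriv_eq, fderiv_eq_zero_of_notMem_tsupport hx, h0]
      simp
  have e1 : ∫ x in cBall d, inner ℝ w (φ x • sphGrad f x) =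
      (∫ x in cBall d, (‖x‖ * φ x) * fderiv ℝ f x w) -
        ∫ x in cBall d, radialDeriv f x * (inner ℝ w x * φ x) := by
    rw [← integral_sub iA.integrableOn iB.integrableOn]
    refine integral_congr_ae (Eventually.of_forall fun x => ?_)
    simp only [inner_smul_right, inner_sphGrad, radialDeriv_eq]
    ring
  rw [e1, eA, eB, neg_sub_neg, ← neg_sub, ← integral_sub iA'.integrableOn iB'.integrableOn]
  congr 1
  refine setIntegral_cBall_congr hd fun x hx => ?_
  have hx0 : ‖x‖ ≠ 0 := norm_ne_zero_iff.2 hx.2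
  have hφd : DifferentiableAt ℝ φ x := hφ.1.differentiable one_ne_zero x
  have hL : HasFDerivAt (fun y => inner ℝ w y) (innerSL ℝ w) x := (innerSL ℝ w).hasFDerivAt
  rw [radialDeriv_eq, fderiv_mul_apply hL hφd, fderiv_mul_apply (hasFDerivAt_norm hx.2) hφd]
  simp only [inner_smul_right, inner_sub_right, inner_sphGrad]
  simp [real_inner_comm x w]
  field_simp
  ring

theorem ae_l2RadialDeriv_eq (hd : 2 ≤ d) (hf : ContDiffOn ℝ 1 f (puncBall d)) :
    ∀ᵐ x ∂(volume.restrict (cBall d)), l2RadialDeriv f x = radialDeriv f x := by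
  have hr := hasL2RadialDeriv_of_contDiffOn hd hf
  have h := HasL2RadialDeriv.ae_unique (h := l2RadialDeriv f)
    (by rw [l2RadialDeriv, dif_pos ⟨_, hr⟩]; exact Exists.choose_spec _) hr
  filter_upwards [ae_mem_puncBall hd, ae_restrict_of_ae h] with x hx hx' using hx' hx

theorem ae_l2SphGrad_eq (hd : 2 ≤ d) (hf : ContDiffOn ℝ 1 f (puncBall d)) :
    ∀ᵐ x ∂(volume.restrict (cBall d)), l2SphGrad f x = sphGrad f x := by
  have hr := hasL2SphGrad_of_contDiffOn hd hf
  have h := HasL2SphGrad.ae_unique (h := l2SphGrad f)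
    (by rw [l2SphGrad, dif_pos ⟨_, hr⟩]; exact Exists.choose_spec _) hr
  filter_upwards [ae_mem_puncBall hd, ae_restrict_of_ae h] with x hx hx' using hx' hx

/-- The energy density in terms of the Euclidean gradient. -/
theorem radialDeriv_sphGrad_energy (f : Euc d → ℝ) {x : Euc d} (hx : x ≠ 0) :
    (1 - ‖x‖ ^ 2) * radialDeriv f x ^ 2 + (1 / ‖x‖ * ‖sphGrad f x‖) ^ 2 =
      ‖gradient f x‖ ^ 2 - inner ℝ (gradient f x) x ^ 2 := by
  have hx0 : ‖x‖ ≠ 0 := norm_ne_zero_iff.2 hx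
  have hD : fderiv ℝ f x x = inner ℝ (gradient f x) x := by
    rw [gradient, InnerProductSpace.toDual_symm_apply]
  rw [mul_pow, sphGrad, norm_sub_sq_real, norm_smul, norm_smul, real_inner_smul_left,
    real_inner_smul_right, radialDeriv_eq, hD, mul_pow, mul_pow, mul_pow,
    Real.norm_eq_abs, Real.norm_eq_abs, sq_abs, sq_abs]
  field_simp
  ring

end ClassicalDerivatives

/-! ### Finiteness of the weighted measure -/

section WeightedMeasure

variable {d : ℕ}

/-- In 1 − r² = (1 + r)(1 − r) only the second factor is singular, and its power is integrable for
exponents above −1. -/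
theorem integrableOn_one_sub_sq_rpow {a : ℝ} (ha : -1 < a) (n : ℕ) :
    IntegrableOn (fun r : ℝ => r ^ n • (1 - r ^ 2) ^ a) (Ioo 0 1) volume := by
  have h1 : IntegrableOn (fun r : ℝ => (1 - r) ^ a) (Ioo 0 1) volume := by
    have h := (intervalIntegral.intervalIntegrable_rpow' (a := 1) (b := 0) ha).comp_sub_left 1
      enorm_ne_top
    simp only [sub_self, sub_zero] at h
    exact ((intervalIntegrable_iff_integrableOn_Ioc_of_le zero_le_one).1 h).mono_set
      Ioo_subset_Ioc_self
  have hc : ContinuousOn (fun r : ℝ => r ^ n * (1 + r) ^ a) (Icc 0 1) :=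
    (continuousOn_pow n).mul ((continuousOn_const.add continuousOn_id).rpow_const fun r hr =>
      Or.inl (add_pos_of_pos_of_nonneg one_pos hr.1).ne')
  refine (IntegrableOn.continuousOn_mul_of_subset hc h1 isCompact_Icc measurableSet_Ioo
    Ioo_subset_Icc_self).congr_fun (fun r hr => ?_) measurableSet_Ioo
  have h2 : 0 ≤ 1 - r := by linarith [hr.2]
  have h3 : 0 ≤ 1 + r := by linarith [hr.1]
  dsimp only
  rw [show 1 - r ^ 2 = (1 + r) * (1 - r) by ring, Real.mul_rpow h3 h2, smul_eq_mul]
  ring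

theorem isFiniteMeasure_ballMeasure (hd : 2 ≤ d) {μ : ℝ} (hμ : -(1 / 2) < μ) :
    IsFiniteMeasure (ballMeasure d μ) := by
  have : Nontrivial (Euc d) := Module.nontrivial_of_finrank_pos (R := ℝ) (by simp; omega)
  refine isFiniteMeasure_withDensity_ofReal (Integrable.hasFiniteIntegral ?_)
  have h1 : IntegrableOn (fun x : Euc d => (1 - ‖x‖ ^ 2) ^ (μ - 1 / 2)) (ball 0 1) volume :=
    (integrableOn_fun_norm_addHaar volume (f := fun r => (1 - r ^ 2) ^ (μ - 1 / 2))).2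
      (integrableOn_one_sub_sq_rpow (by linarith) _)
  have h2 : IntegrableOn (fun x : Euc d => (1 - ‖x‖ ^ 2) ^ (μ - 1 / 2)) (sphere 0 1) volume := by
    rw [IntegrableOn, Measure.restrict_eq_zero.2 (Measure.addHaar_sphere _ _ _)]
    exact integrable_zero_measure
  have h3 := h1.union h2
  rwa [ball_union_sphere] at h3

theorem ballMeasure_absolutelyContinuous (μ : ℝ) :
    ballMeasure d μ ≪ volume.restrict (cBall d) := withDensity_absolutelyContinuous _ _

end WeightedMeasure

/-! ### `C²` functions in the form domain -/

section FormDomain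

variable {d : ℕ} {f : Euc d → ℝ}

theorem measurable_radialDeriv (f : Euc d → ℝ) : Measurable (radialDeriv f) := by
  unfold radialDeriv
  have h : ∀ w : Euc d, Measurable fun x => fderiv ℝ f x w := fun w =>
    measurable_fderiv_apply_const ℝ f w
  have h' : ∀ j : Fin d, Measurable fun x : Euc d => x j := fun j =>
    (EuclideanSpace.proj j : Euc d →L[ℝ] ℝ).continuous.measurable
  exact Finset.measurable_sum _ fun j _ => ((h' j).div measurable_norm).mul (h _)

theorem measurable_sphGrad (f : Euc d → ℝ) : Measurable (sphGrad f) := by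
  unfold sphGrad
  have h : Measurable (gradient f) :=
    (InnerProductSpace.toDual ℝ (Euc d)).symm.continuous.measurable.comp (measurable_fderiv ℝ f)
  exact (measurable_norm.smul h).sub ((measurable_radialDeriv f).smul measurable_id)

theorem contDiffOn_puncBall {n : WithTop ℕ∞} (hf : ContDiffOn ℝ n f (cBall d)) (hn : 1 ≤ n) :
    ContDiffOn ℝ 1 f (puncBall d) := (hf.mono puncBall_subset_cBall).of_le hn

/-- A `C²` function of energy at most one in the classical sense lies in the form domain. -/
theorem inFormDomain_and_energyLeOne (hd : 2 ≤ d) {μ : ℝ} (hμ : -(1 / 2) < μ)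
    (hf : ContDiffOn ℝ 2 f (cBall d))
    (hΓ : ∀ x ∈ puncBall d, ‖gradient f x‖ ^ 2 - inner ℝ (gradient f x) x ^ 2 ≤ 1) :
    InFormDomain μ f ∧ EnergyLeOne f := by
  have := isFiniteMeasure_ballMeasure hd hμ
  have hac := ballMeasure_absolutelyContinuous (d := d) μ
  have hf1 := contDiffOn_puncBall hf one_le_two
  have hr := hasL2RadialDeriv_of_contDiffOn hd hf1
  have hs := hasL2SphGrad_of_contDiffOn hd hf1
  have er := ae_l2RadialDeriv_eq hd hf1
  have es := ae_l2SphGrad_eq hd hf1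
  have hU := ae_mem_puncBall hd
  have hle : ∀ x ∈ puncBall d, (√(1 - ‖x‖ ^ 2) * radialDeriv f x) ^ 2 +
      (1 / ‖x‖ * ‖sphGrad f x‖) ^ 2 ≤ 1 := fun x hx => by
    rw [mul_pow, Real.sq_sqrt (one_sub_norm_sq_pos hx).le, radialDeriv_sphGrad_energy f hx.2]
    exact hΓ x hx
  -- The approximating sequence is constantly f; bounded functions are square integrable because the
  -- measure is finite.
  refine ⟨⟨?_, ⟨_, hr⟩, ⟨_, hs⟩, ?_, ?_, fun _ => f, fun _ => hf, ?_, ?_, ?_⟩, ?_⟩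
  · obtain ⟨C, hC⟩ := (isCompact_closedBall (0 : Euc d) 1).exists_bound_of_continuousOn
      hf.continuousOn
    refine MemLp.of_bound ?_ C (hac.ae_le ?_)
    · exact (hf.continuousOn.aestronglyMeasurable
        isClosed_closedBall.measurableSet).mono_ac hac
    · filter_upwards [ae_restrict_mem isClosed_closedBall.measurableSet] with x hx using hC x hx
  · refine MemLp.ae_eq (f := fun x => √(1 - ‖x‖ ^ 2) * radialDeriv f x) (hac.ae_le ?_)
      (MemLp.of_bound ?_ 1 (hac.ae_le ?_))
    · filter_upwards [er] with x hx
      rw [hx]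
    · have h1 := measurable_radialDeriv f
      exact Measurable.aestronglyMeasurable (by fun_prop)
    · filter_upwards [hU] with x hx
      rw [Real.norm_eq_abs]
      exact abs_le_one_iff_mul_self_le_one.2
        (by nlinarith [hle x hx, sq_nonneg (1 / ‖x‖ * ‖sphGrad f x‖)])
  · refine MemLp.ae_eq (f := fun x => 1 / ‖x‖ * ‖sphGrad f x‖) (hac.ae_le ?_)
      (MemLp.of_bound ?_ 1 (hac.ae_le ?_))
    · filter_upwards [es] with x hx
      rw [hx]
    · have h1 := measurable_sphGrad f
      exact Measurable.aestronglyMeasurable (by fun_prop)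
    · filter_upwards [hU] with x hx
      rw [Real.norm_eq_abs]
      exact abs_le_one_iff_mul_self_le_one.2
        (by nlinarith [hle x hx, sq_nonneg (√(1 - ‖x‖ ^ 2) * radialDeriv f x)])
  · simp
  · refine tendsto_const_nhds.congr fun n => ?_
    rw [eq_comm, eLpNorm_congr_ae (g := fun _ => (0 : ℝ)), eLpNorm_zero']
    refine hac.ae_le ?_
    filter_upwards [er] with x hx
    simp [hx]
  · refine tendsto_const_nhds.congr fun n => ?_
    rw [eq_comm, eLpNorm_congr_ae (g := fun _ => (0 : ℝ)), eLpNorm_zero']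
    refine hac.ae_le ?_
    filter_upwards [es] with x hx
    simp [hx]
  · unfold EnergyLeOne energyDensity
    filter_upwards [hU, er, es] with x hx h1 h2
    have h3 := radialDeriv_sphGrad_energy f hx.2
    rw [mul_pow, div_pow, one_pow] at h3
    rw [h1, h2, real_inner_self_eq_norm_sq, ← sq, h3]
    exact hΓ x hx

end FormDomain

/-! ### Regularized distance functions and the two inequalities -/

section Barrier

variable {d : ℕ}

/-- A smooth regularization of `x ↦ ballDist x y - π / 2`, of energy at most one. -/
noncomputable def ballBarrier (y : Euc d) (η : ℝ) (x : Euc d) : ℝ :=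
  -Real.arcsin ((inner ℝ y x + √(1 - ‖y‖ ^ 2) * √(1 + η ^ 2 - ‖x‖ ^ 2)) / √(1 + 3 * η))

/-- Cauchy–Schwarz for the plane vectors (|y|, t), of norm one, and (|x|, s), of squared norm 1 +
η². -/
theorem inner_add_sqrt_sq_le {x y : Euc d} (hx : x ∈ cBall d) (hy : y ∈ cBall d) (η : ℝ) :
    (inner ℝ y x + √(1 - ‖y‖ ^ 2) * √(1 + η ^ 2 - ‖x‖ ^ 2)) ^ 2 ≤ 1 + η ^ 2 := by
  have h1 := Real.sq_sqrt (one_sub_norm_sq_nonneg hy)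
  have h2 : √(1 + η ^ 2 - ‖x‖ ^ 2) ^ 2 = 1 + η ^ 2 - ‖x‖ ^ 2 :=
    Real.sq_sqrt (by nlinarith [one_sub_norm_sq_nonneg hx])
  set t := √(1 - ‖y‖ ^ 2)
  set s := √(1 + η ^ 2 - ‖x‖ ^ 2)
  have ht : 0 ≤ t := Real.sqrt_nonneg _
  have hs : 0 ≤ s := Real.sqrt_nonneg _
  have h3 : |inner ℝ y x + t * s| ≤ |‖y‖ * ‖x‖ + t * s| := by
    rw [abs_of_nonneg (by positivity : 0 ≤ ‖y‖ * ‖x‖ + t * s)]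
    refine (abs_add_le _ _).trans ?_
    rw [abs_of_nonneg (by positivity : 0 ≤ t * s)]
    exact add_le_add_left (abs_real_inner_le_norm y x) _
  have h4 := sq_le_sq.2 h3
  nlinarith [sq_nonneg (‖y‖ * s - t * ‖x‖)]

theorem inner_add_sqrt_div_sq_lt_one {x y : Euc d} (hx : x ∈ cBall d) (hy : y ∈ cBall d) {η : ℝ}
    (hη : 0 < η) (hη1 : η ≤ 1) :
    ((inner ℝ y x + √(1 - ‖y‖ ^ 2) * √(1 + η ^ 2 - ‖x‖ ^ 2)) / √(1 + 3 * η)) ^ 2 < 1 := by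
  rw [div_pow, Real.sq_sqrt (by positivity), div_lt_one (by positivity)]
  nlinarith [inner_add_sqrt_sq_le hx hy η]

theorem contDiffOn_ballBarrier {y : Euc d} (hy : y ∈ cBall d) {η : ℝ}
    (hη : 0 < η) (hη1 : η ≤ 1) : ContDiffOn ℝ 2 (ballBarrier y η) (cBall d) := by
  intro x hx
  have h1 := inner_add_sqrt_div_sq_lt_one hx hy hη hη1
  have hs : 1 + η ^ 2 - ‖x‖ ^ 2 ≠ 0 := by
    have := one_sub_norm_sq_nonneg hx
    have := pow_pos hη 2
    linarith
  have hG : ContDiffAt ℝ 2 (fun x => (inner ℝ y x + √(1 - ‖y‖ ^ 2) * √(1 + η ^ 2 - ‖x‖ ^ 2)) /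
      √(1 + 3 * η)) x :=
    (((innerSL ℝ y).contDiff.contDiffAt).add (contDiffAt_const.mul
      ((contDiffAt_const.sub (contDiffAt_id.norm_sq ℝ)).sqrt hs))).div_const _
  refine (ContDiffAt.neg ?_).contDiffWithinAt
  refine (Real.contDiffAt_arcsin (fun h => ?_) (fun h => ?_)).comp x hG <;>
  · rw [h] at h1
    norm_num at h1

theorem hasGradientAt_ballBarrier {x y : Euc d} (hx : x ∈ cBall d) (hy : y ∈ cBall d) {η : ℝ}
    (hη : 0 < η) (hη1 : η ≤ 1) :
    HasGradientAt (ballBarrier y η)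
      (-(1 / √(1 - ((inner ℝ y x + √(1 - ‖y‖ ^ 2) * √(1 + η ^ 2 - ‖x‖ ^ 2)) / √(1 + 3 * η)) ^ 2) /
        √(1 + 3 * η)) • (y - (√(1 - ‖y‖ ^ 2) / √(1 + η ^ 2 - ‖x‖ ^ 2)) • x)) x := by
  have h1 := inner_add_sqrt_div_sq_lt_one hx hy hη hη1
  have hs : 1 + η ^ 2 - ‖x‖ ^ 2 ≠ 0 := by
    have := one_sub_norm_sq_nonneg hx
    have := pow_pos hη 2
    linarith
  have hL : HasFDerivAt (fun x => inner ℝ y x) (innerSL ℝ y) x := (innerSL ℝ y).hasFDerivAt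
  have hS := (((hasStrictFDerivAt_norm_sq x).hasFDerivAt.const_sub (1 + η ^ 2)).sqrt hs).const_mul
    (√(1 - ‖y‖ ^ 2))
  have hG := (hL.add hS).mul_const (√(1 + 3 * η))⁻¹
  have hA := Real.hasDerivAt_arcsin
    (x := (inner ℝ y x + √(1 - ‖y‖ ^ 2) * √(1 + η ^ 2 - ‖x‖ ^ 2)) / √(1 + 3 * η))
    (fun h => by rw [h] at h1; norm_num at h1) (fun h => by rw [h] at h1; norm_num at h1)
  have hF := (hA.comp_hasFDerivAt x hG).neg
  rw [hasGradientAt_iff_hasFDerivAt]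
  refine hF.congr_fderiv ?_
  ext v
  simp
  ring

/-- Right side minus left side is 3η − 2amη² − t²η² + m²η²X. Since mη ≤ ms = t ≤ 1, the two negative
terms cost at most 2η and η, which is where the 3 in the normalization comes from. -/
theorem barrier_energy_aux {a t s m η X : ℝ} (hη : 0 < η) (hη1 : η ≤ 1) (hsη : η ≤ s)
    (ht : 0 ≤ t) (ht1 : t ≤ 1) (hm : 0 ≤ m) (hms : m * s = t) (hX : X = 1 + η ^ 2 - s ^ 2)
    (hX0 : 0 ≤ X) (ha : |a| ≤ 1) :
    1 - t ^ 2 - 2 * (m * a) + m ^ 2 * X - (a - m * X) ^ 2 ≤ 1 + 3 * η - (a + t * s) ^ 2 := by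
  have hmη : m * η ≤ 1 := (mul_le_mul_of_nonneg_left hsη hm).trans (hms.trans_le ht1)
  have h0 : 0 ≤ m * η := mul_nonneg hm hη.le
  have ham : a * (m * η) ≤ 1 :=
    (mul_le_mul_of_nonneg_right (abs_le.1 ha).2 h0).trans (by rwa [one_mul])
  have k1 : a * (m * η) * η ≤ η := mul_le_of_le_one_left hη.le ham
  have k2 : (m * s) ^ 2 * η ^ 2 ≤ η := by
    rw [hms]
    calc t ^ 2 * η ^ 2 ≤ 1 * η ^ 2 :=
          mul_le_mul_of_nonneg_right (pow_le_one₀ ht ht1) (sq_nonneg η)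
      _ ≤ η := by nlinarith
  have k3 : 0 ≤ (m * η) ^ 2 * (1 + η ^ 2 - s ^ 2) := mul_nonneg (sq_nonneg _) (hX ▸ hX0)
  rw [hX, ← hms]
  linarith

/-- The gradient is −(rc)⁻¹(y − (t/s)x) with (rc)² = 1 + 3η − (a + ts)², so the claim is that y −
(t/s)x has energy at most (rc)². -/
theorem ballBarrier_energy_le {x y : Euc d} (hx : x ∈ cBall d) (hy : y ∈ cBall d) {η : ℝ}
    (hη : 0 < η) (hη1 : η ≤ 1) :
    ‖gradient (ballBarrier y η) x‖ ^ 2 - inner ℝ (gradient (ballBarrier y η) x) x ^ 2 ≤ 1 := by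
  rw [(hasGradientAt_ballBarrier hx hy hη hη1).gradient]
  have h1 := inner_add_sqrt_div_sq_lt_one hx hy hη hη1
  have ht2 := Real.sq_sqrt (one_sub_norm_sq_nonneg hy)
  have hx1 := one_sub_norm_sq_nonneg hx
  have hs2 : √(1 + η ^ 2 - ‖x‖ ^ 2) ^ 2 = 1 + η ^ 2 - ‖x‖ ^ 2 :=
    Real.sq_sqrt (by nlinarith)
  have hsη : η ≤ √(1 + η ^ 2 - ‖x‖ ^ 2) := Real.le_sqrt_of_sq_le (by linarith)
  have hc2 : √(1 + 3 * η) ^ 2 = 1 + 3 * η := Real.sq_sqrt (by positivity)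
  have hc : 0 < √(1 + 3 * η) := Real.sqrt_pos.2 (by positivity)
  have ht : 0 ≤ √(1 - ‖y‖ ^ 2) := Real.sqrt_nonneg _
  have ha : |inner ℝ y x| ≤ ‖y‖ * ‖x‖ := abs_real_inner_le_norm _ _
  set t := √(1 - ‖y‖ ^ 2)
  set s := √(1 + η ^ 2 - ‖x‖ ^ 2)
  set c := √(1 + 3 * η)
  set a := inner ℝ y x with ha'
  have hs : 0 < s := hη.trans_le hsη
  have hr2 : √(1 - ((a + t * s) / c) ^ 2) ^ 2 = 1 - ((a + t * s) / c) ^ 2 :=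
    Real.sq_sqrt (by linarith)
  have hr : 0 < √(1 - ((a + t * s) / c) ^ 2) := Real.sqrt_pos.2 (by linarith)
  set r := √(1 - ((a + t * s) / c) ^ 2)
  have hrc : (r * c) ^ 2 = 1 + 3 * η - (a + t * s) ^ 2 := by
    rw [mul_pow, hr2, div_pow, sub_mul, div_mul_cancel₀ _ (by positivity), one_mul, hc2]
  have hq : ‖y - (t / s) • x‖ ^ 2 - inner ℝ (y - (t / s) • x) x ^ 2 ≤ (r * c) ^ 2 := by
    rw [norm_sub_sq_real, inner_sub_left, real_inner_smul_left, real_inner_smul_right, ← ha',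
      norm_smul, mul_pow, Real.norm_eq_abs, sq_abs, real_inner_self_eq_norm_sq, hrc]
    have hy1 := one_sub_norm_sq_nonneg hy
    have ht1 : t ≤ 1 := by
      rw [← one_pow 2] at hy1
      exact Real.sqrt_le_one.2 (by linarith [sq_nonneg ‖y‖])
    have hn : ‖y‖ * ‖x‖ ≤ 1 :=
      mul_le_one₀ (by simpa using hy) (norm_nonneg _) (by simpa using hx)
    have key := barrier_energy_aux (a := a) (m := t / s) (X := ‖x‖ ^ 2) hη hη1 hsη ht ht1
      (by positivity) (div_mul_cancel₀ _ hs.ne') (by linarith) (sq_nonneg _) (ha.trans hn)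
    have hy2 : ‖y‖ ^ 2 = 1 - t ^ 2 := by linarith
    rw [hy2]
    linarith
  have hrcp : 0 < (r * c) ^ 2 := by positivity
  rw [div_div,
    norm_smul, real_inner_smul_left, mul_pow, mul_pow, Real.norm_eq_abs, sq_abs, ← mul_sub,
    neg_sq, div_pow, one_pow, one_div_mul_eq_div]
  exact (div_le_one hrcp).2 hq

theorem ballBarrier_zero {x y : Euc d} :
    ballBarrier y 0 x = ballDist x y - Real.pi / 2 := by
  rw [ballBarrier, ballDist, Real.arccos, real_inner_comm]
  simp [mul_comm]

theorem tendsto_ballBarrier (x y : Euc d) :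
    Tendsto (fun η => ballBarrier y η x) (𝓝[>] 0) (𝓝 (ballDist x y - Real.pi / 2)) := by
  rw [← ballBarrier_zero]
  refine Tendsto.mono_left ?_ nhdsWithin_le_nhds
  have h1 : ContinuousAt (fun η : ℝ => √(1 + 3 * η)) 0 := by fun_prop
  have h2 : ContinuousAt (fun η : ℝ => inner ℝ y x + √(1 - ‖y‖ ^ 2) * √(1 + η ^ 2 - ‖x‖ ^ 2)) 0 :=
    by fun_prop
  exact (Real.continuous_arcsin.continuousAt.comp (h2.div h1 (by simp))).neg

/-- The regularized distances to y are admissible competitors; the constant π/2 drops out of the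
difference of values at x and y as η → 0. -/
theorem ballDist_le_intrinsicDist (hd : 2 ≤ d) {μ : ℝ} (hμ : -(1 / 2) < μ) {x y : Euc d}
    (hy : y ∈ cBall d) : (ballDist x y : EReal) ≤ intrinsicDist μ x y := by
  have hlim : Tendsto (fun η => ((ballBarrier y η x - ballBarrier y η y : ℝ) : EReal)) (𝓝[>] 0)
      (𝓝 (ballDist x y : EReal)) := by
    refine (continuous_coe_real_ereal.tendsto _).comp ?_
    have h := (tendsto_ballBarrier x y).sub (tendsto_ballBarrier y y)
    rwa [ballDist_self hy, sub_sub_sub_cancel_right, sub_zero] at h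
  refine le_of_tendsto hlim ?_
  filter_upwards [Ioc_mem_nhdsGT zero_lt_one] with η hη
  have hc := contDiffOn_ballBarrier hy hη.1 hη.2
  obtain ⟨h1, h2⟩ := inFormDomain_and_energyLeOne hd hμ hc fun z hz =>
    ballBarrier_energy_le (puncBall_subset_cBall hz) hy hη.1 hη.2
  exact le_sSup ⟨_, h1, hc.continuousOn, h2, rfl⟩

/-- A continuous competitor agrees with its Lipschitz representative almost everywhere, hence
everywhere, the closed ball being the closure of its interior. -/
theorem intrinsicDist_le_ballDist (hd : 2 ≤ d) (μ : ℝ) {x y : Euc d} (hx : x ∈ cBall d)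
    (hy : y ∈ cBall d) : intrinsicDist μ x y ≤ (ballDist x y : EReal) := by
  refine sSup_le ?_
  rintro _ ⟨f, hf, hfc, hΓ, rfl⟩
  obtain ⟨g, hgc, hfg, hg⟩ := exists_lipschitz_representative hd hf.2.1 hf.2.2.1 hΓ
  have heq : EqOn f g (cBall d) := Measure.eqOn_of_ae_eq hfg hfc hgc (by
    rw [interior_closedBall _ one_ne_zero, closure_ball _ one_ne_zero])
  rw [heq hx, heq hy]
  exact_mod_cast (le_abs_self _).trans (hg x hx y hy)

end Barrier

theorem lemma2 (d : ℕ) (hd : 2 ≤ d) (μ : ℝ) (hμ : -(1 / 2) < μ) :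
    (∀ x ∈ cBall d, ∀ y ∈ cBall d, intrinsicDist μ x y = (ballDist x y : EReal)) ∧
    (∀ f : Euc d → ℝ, (∃ h, HasL2RadialDeriv f h) → (∃ h, HasL2SphGrad f h) → EnergyLeOne f →
      (∃ F : Euc (d + 1) → ℝ, ContinuousOn F (hemisphere d) ∧
        (∀ᵐ ξ : sphere (0 : Euc (d + 1)) 1 ∂(areaMeasure d),
          (ξ : Euc (d + 1)) ∈ hemisphere d → F ξ = f (dropLast (ξ : Euc (d + 1)))) ∧
        ∀ ξ ∈ hemisphere d, ∀ ζ ∈ hemisphere d, |F ξ - F ζ| ≤ geoDist ξ ζ) ∧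
      (∃ g : Euc d → ℝ, ContinuousOn g (cBall d) ∧
        (∀ᵐ x ∂(volume.restrict (cBall d)), f x = g x) ∧
        ∀ x ∈ cBall d, ∀ y ∈ cBall d, |g x - g y| ≤ ballDist x y)) := by
  refine ⟨fun x hx y hy => le_antisymm (intrinsicDist_le_ballDist hd μ hx hy)
    (ballDist_le_intrinsicDist hd hμ hy), fun f hr hs hΓ => ?_⟩
  obtain ⟨g, hgc, hfg, hg⟩ := exists_lipschitz_representative hd hr hs hΓ
  exact ⟨exists_lipschitz_hemisphere_representative hgc hfg hg, g, hgc, hfg, hg⟩
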